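/- **Model.** Let $\Omega$ be a compact metric space with its Borel $\sigma$-algebra. The two-stage distributionally robust linear program (2-DRLP) is $$\min\{f(x)=c^\top x+\mathbb Q(x) : x\in\mathcal X\},\qquad \mathbb Q(x)=\sup_{P\in\mathfrak P}\mathbb E_P[Q(x,\tilde\omega)],$$ where $\mathcal X=\{x\in\mathbb R^{d_x}: Ax\ge b,\ x\ge 0\}$ is non-empty and compact, $\mathfrak P\neq\emptyset$ is a set of probability measures on $\Omega$, and $Q(x,\omega)=\min\{g^\top y: Wy=r(\omega)-T(\omega)x,\ y\ge 0\}$. Here $W,g$ are fixed, $r,T$ are continuous on $\Omega$, the second-stage problem is feasible for all $x\in\mathcal X$, $\omega\in\Omega$, the dual feasible set $\Pi=\{\pi: W^\top\pi\le g\}$ is non-empty and compact, and $Q\ge 0$ on $\mathcal X\times\Omega$. **Distance.** For a class $\mathcal F$ of measurable functions on $\Omega$, integrable under every $P\in\mathfrak P$, put $d(P,P')=\sup_{F\in\mathcal F}|\mathbb E_P F-\mathbb E_{P'}F|$ and let $\mathbb H$ be the associated Hausdorff distance between sets of distributions. It is assumed that each $Q(x,\cdot)$, $x\in\mathcal X$,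 is a uniform limit of linear combinations of constants and members of $\mathcal F$ (e.g. $\mathcal F\supseteq\{Q(x,\cdot):x\in\mathcal X\}$, or $\mathcal F$ is the class defining the Kantorovich or the bounded Lipschitz metric). **Algorithm (DRSD, run without termination).** Let $\gamma\in(0,1)$, $\hat x^0\in\mathcal X$, $f^0=0$, $\Pi^0=\{0\}$, $\mathcal L^0=\emptyset$, and let $\Omega^0$ be a finite (possibly empty) initial sample. In iteration $k\ge1$: 1. Choose the candidate $x^k\in\arg\min_{x\in\mathcal X}f^{k-1}(x)$, then generate $\omega^k$ and set $\Omega^k=\Omega^{k-1}\cup\{\omega^k\}$. A non-empty set $\widehat{\mathfrak P}^k$ of probability distributions on the finite set $\Omega^k$ (the approximate ambiguity set) is given. 2. Let $\pi(x^k,\omega^k)$ and $\pi(\hat x^{k-1},\omega^k)$ be vertices of $\Pi$ maximizing $\pi^\top[r(\omega^k)-T(\omega^k)x]$ over $\Pi$ for $x=x^k$ and $x=\hat x^{k-1}$, and put $\Pi^k=\Pi^{k-1}\cup\{\pi(x^k,\omega^k),\pi(\hat x^{k-1},\omega^k)\}$ and $Q^k(x,\omega)=\max_{\pi\in\Pi^k}\pi^\top[r(\omega)-T(\omega)x]$.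 For the other $\omega\in\Omega^k$ let $\pi(x,\omega)\in\arg\max_{\pi\in\Pi^k}\pi^\top[r(\omega)-T(\omega)x]$, for $x=x^k$ and $x=\hat x^{k-1}$. 3. For $x=x^k$ and for $x=\hat x^{k-1}$, let $p$ be a maximizer of $\sum_{\omega\in\Omega^k}p(\omega)Q^k(x,\omega)$ over $\widehat{\mathfrak P}^k$ (assumed to exist), and form the affine function $z\mapsto\sum_{\omega\in\Omega^k}p(\omega)\,\pi(x,\omega)^\top[r(\omega)-T(\omega)z]$. The set $\mathcal L^k$ consists of these two affine functions and of all $\theta^k\ell$, $\ell\in\mathcal L^{k-1}$. Put $f^k(z)=c^\top z+\max_{\ell\in\mathcal L^k}\ell(z)$. 4. If $f^k(x^k)-f^k(\hat x^{k-1})<\gamma\,[f^{k-1}(x^k)-f^{k-1}(\hat x^{k-1})]$, the new incumbent is $\hat x^k=x^k$; otherwise $\hat x^k=\hat x^{k-1}$. The observations $\omega^1,\omega^2,\dots$ are i.i.d. with some law $\mu$ on $\Omega$, and are generated sequentially: there is a filtration $(\mathcal G_k)_{k\ge0}$ such that $\omega^k$ is $\mathcal G_k$-measurable and independent of $\mathcal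 G_{k-1}$, while $x^k$ and $\hat x^{k-1}$ are $\mathcal G_{k-1}$-measurable. The initial sample $\Omega^0$ is contained in the support of $\mu$. **Conditions on the approximate ambiguity sets.** Almost surely: (i) for every $k\ge2$, the factor $\theta^k\in[0,1]$ used in step 3 is such that $\Theta^k(P):=\theta^kP+(1-\theta^k)\delta_{\omega^k}\in\widehat{\mathfrak P}^k$ for every $P\in\widehat{\mathfrak P}^{k-1}$; moreover $\theta^k\to1$ as $k\to\infty$ (as for the factor $\theta^k=\frac{k-1}{k}$ of the empirical frequencies); (ii) $\mathbb H(\widehat{\mathfrak P}^k,\mathfrak P)\to0$ as $k\to\infty$. **Theorem.** Let $\{x^k\}$ and $\{\hat x^k\}$ be the candidate and incumbent solutions generated by the algorithm. With probability one, there is a subsequence $\{\hat x^k\}_{k\in\mathcal K}$ of the incumbent solutions every accumulation point of which is an optimal solution of the 2-DRLP. -/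

import Mathlib

open MeasureTheory ProbabilityTheory Filter Topology Matrix
open scoped ENNReal

namespace DRSD

noncomputable section

/-- Data of a two-stage distributionally robust linear program with fixed recourse: only the
right-hand side `r` and the technology matrix `T` depend on the random outcome `ω`. -/
structure Problem (Ω : Type*) [MeasurableSpace Ω] (dx m₁ dy m : ℕ) where
  A : Matrix (Fin m₁) (Fin dx) ℝ
  b : Fin m₁ → ℝ
  c : Fin dx → ℝ
  W : Matrix (Fin m) (Fin dy) ℝ
  g : Fin dy → ℝ
  r : Ω → Fin m → ℝ
  T : Ω → Matrix (Fin m) (Fin dx) ℝ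
  ambiguity : Set (Measure Ω)

section Model

variable {Ω : Type*} [MeasurableSpace Ω] {dx m₁ dy m : ℕ} (D : Problem Ω dx m₁ dy m)

/-- First-stage feasible region `{x | A x ≥ b, x ≥ 0}`. -/
def Problem.feasible : Set (Fin dx → ℝ) :=
  {x | D.b ≤ D.A *ᵥ x ∧ 0 ≤ x}

/-- Second-stage feasible region `{y | W y = r(ω) - T(ω) x, y ≥ 0}`. -/
def Problem.secondStage (x : Fin dx → ℝ) (ω : Ω) : Set (Fin dy → ℝ) :=
  {y | D.W *ᵥ y = D.r ω - D.T ω *ᵥ x ∧ 0 ≤ y}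

/-- Recourse cost `Q(x, ω)`: the optimal value of the second-stage linear program. -/
def Problem.recourse (x : Fin dx → ℝ) (ω : Ω) : ℝ :=
  sInf ((fun y => D.g ⬝ᵥ y) '' D.secondStage x ω)

/-- Dual feasible region of the second-stage linear program. -/
def Problem.dualFeasible : Set (Fin m → ℝ) :=
  {π | (D.W)ᵀ *ᵥ π ≤ D.g}

/-- Dual objective `πᵀ (r(ω) - T(ω) x)`. -/
def Problem.dualValue (x : Fin dx → ℝ) (ω : Ω) (π : Fin m → ℝ) : ℝ :=
  π ⬝ᵥ (D.r ω - D.T ω *ᵥ x)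

/-- `π` is an optimal vertex of the dual of the second-stage linear program at `(x, ω)`. -/
def Problem.IsOptimalDualVertex (x : Fin dx → ℝ) (ω : Ω) (π : Fin m → ℝ) : Prop :=
  π ∈ Set.extremePoints ℝ D.dualFeasible ∧ IsMaxOn (D.dualValue x ω) D.dualFeasible π

/-- Worst-case expected recourse cost. -/
def Problem.worstCase (x : Fin dx → ℝ) : ℝ :=
  sSup ((fun P : Measure Ω => ∫ ω, D.recourse x ω ∂P) '' D.ambiguity)

/-- First-stage objective `f(x) = cᵀ x + max_P E_P[Q(x, ω)]`. -/
def Problem.objective (x : Fin dx → ℝ) : ℝ :=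
  D.c ⬝ᵥ x + D.worstCase x

/-- Optimal solutions of the two-stage distributionally robust linear program. -/
def Problem.IsOptimal (x : Fin dx → ℝ) : Prop :=
  x ∈ D.feasible ∧ IsMinOn D.objective D.feasible x

/-- Standing assumptions on the model. Continuity of `r` and `T` on the compact space `Ω` makes
the expectations of `T` under `P ∈ ambiguity` uniformly bounded. -/
structure Problem.StandingAssumptions [TopologicalSpace Ω] : Prop where
  feasible_nonempty : D.feasible.Nonempty
  feasible_compact : IsCompact D.feasible
  complete_recourse : ∀ x ∈ D.feasible, ∀ ω, (D.secondStage x ω).Nonempty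
  dual_nonempty : D.dualFeasible.Nonempty
  dual_compact : IsCompact D.dualFeasible
  continuous_r : Continuous D.r
  continuous_T : Continuous D.T
  recourse_nonneg : ∀ x ∈ D.feasible, ∀ ω, 0 ≤ D.recourse x ω
  ambiguity_nonempty : D.ambiguity.Nonempty
  ambiguity_prob : ∀ P ∈ D.ambiguity, IsProbabilityMeasure P

end Model

section Distances

variable {Ω : Type*} [MeasurableSpace Ω]

/-- Uniform distance of expectations over a class `𝓕` of test functions. -/
def zetaDist (𝓕 : Set (Ω → ℝ)) (P P' : Measure Ω) : ℝ≥0∞ :=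
  ⨆ F ∈ 𝓕, edist (∫ ω, F ω ∂P) (∫ ω, F ω ∂P')

/-- `sup_{P ∈ 𝔔} inf_{P' ∈ 𝔓} d(P, P')`. -/
def setDeviation (𝓕 : Set (Ω → ℝ)) (𝔓 𝔔 : Set (Measure Ω)) : ℝ≥0∞ :=
  ⨆ P ∈ 𝔔, ⨅ P' ∈ 𝔓, zetaDist 𝓕 P P'

/-- Hausdorff distance between two sets of probability distributions. -/
def hausdorffDist (𝓕 : Set (Ω → ℝ)) (𝔓 𝔔 : Set (Measure Ω)) : ℝ≥0∞ :=
  max (setDeviation 𝓕 𝔓 𝔔) (setDeviation 𝓕 𝔔 𝔓)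

/-- The map `Θ`: rescale all weights by `θ` and add the weight `1 - θ` at the outcome `ω`. -/
def Theta (θ : ℝ) (ω : Ω) (P : Measure Ω) : Measure Ω :=
  ENNReal.ofReal θ • P + ENNReal.ofReal (1 - θ) • Measure.dirac ω

/-- Requirements on the class `𝓕` defining the distance: its members are measurable and have
expectations under every `P` in the ambiguity set, and, up to uniform approximation, linear
combinations of its members and constants yield the recourse costs `Q(x, ·)`. For instance `𝓕` may
consist of the functions `Q(x, ·)` themselves, or of all (bounded) Lipschitz functions with
constant one. -/
structure Problem.AdmissibleClass {dx m₁ dy m : ℕ} (D : Problem Ω dx m₁ dy m)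
    (𝓕 : Set (Ω → ℝ)) : Prop where
  measurable : ∀ F ∈ 𝓕, Measurable F
  integrable : ∀ F ∈ 𝓕, ∀ P ∈ D.ambiguity, Integrable F P
  approximates : ∀ x ∈ D.feasible, ∀ ε > 0, ∃ h ∈ Submodule.span ℝ (insert 1 𝓕),
    ∀ ω, |D.recourse x ω - h ω| ≤ ε

end Distances

section Algorithm

/-- Everything recorded along one run of the method. Entries with index `k ≥ 1` belong to
iteration `k`; `incumbent 0` is the incumbent given as input.
* `init`: initial sample; `obs k`: the outcome generated in iteration `k`;
* `approxSet k`: the approximate ambiguity set; `θ k`: the rescaling factor of older cuts;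
* `candidate k`, `incumbent k`: candidate, and incumbent at the end of iteration `k`;
* `candDual k ω`, `incDual k ω`: the dual vectors chosen in iteration `k` for the outcome `ω`, at
  `candidate k` and at `incumbent (k - 1)` respectively;
* `candDist k`, `incDist k`: the extremal distributions at these two points. -/
structure Trace (Ω : Type*) [MeasurableSpace Ω] (dx m : ℕ) where
  init : Finset Ω
  obs : ℕ → Ω
  approxSet : ℕ → Set (Measure Ω)
  θ : ℕ → ℝ
  candidate : ℕ → Fin dx → ℝ
  incumbent : ℕ → Fin dx → ℝ
  candDual : ℕ → Ω → Fin m → ℝ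
  incDual : ℕ → Ω → Fin m → ℝ
  candDist : ℕ → Measure Ω
  incDist : ℕ → Measure Ω

variable {Ω : Type*} [MeasurableSpace Ω] {dx m₁ dy m : ℕ}

open Classical in
/-- The sample `Ω^k`. -/
def Trace.sample (R : Trace Ω dx m) : ℕ → Finset Ω
  | 0 => R.init
  | k + 1 => insert (R.obs (k + 1)) (R.sample k)

/-- The set `Π^k` of dual vectors discovered so far, starting from `{0}`. -/
def Trace.dualSet (R : Trace Ω dx m) : ℕ → Set (Fin m → ℝ)
  | 0 => {0}
  | k + 1 => R.dualSet k ∪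
      {R.candDual (k + 1) (R.obs (k + 1)), R.incDual (k + 1) (R.obs (k + 1))}

variable (D : Problem Ω dx m₁ dy m)

/-- The approximate recourse cost `Q^k(x, ω) = max_{π ∈ Π^k} πᵀ (r(ω) - T(ω) x)`. -/
def Trace.approxRecourse (R : Trace Ω dx m) (k : ℕ) (x : Fin dx → ℝ) (ω : Ω) : ℝ :=
  sSup (D.dualValue x ω '' R.dualSet k)

/-- Objective of the distribution separation problem, `∑_{ω ∈ Ω^k} p(ω) Q^k(x, ω)`. -/
def Trace.separationValue (R : Trace Ω dx m) (k : ℕ) (x : Fin dx → ℝ) (P : Measure Ω) : ℝ :=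
  ∑ ω ∈ R.sample k, P.real {ω} * R.approxRecourse D k x ω

/-- The coefficients `(α, β)` of the affine function `∑_{ω ∈ Ω^k} p(ω) π(ω)ᵀ (r(ω) - T(ω) x)`. -/
def Trace.cut (R : Trace Ω dx m) (k : ℕ) (P : Measure Ω) (π : Ω → Fin m → ℝ) :
    ℝ × (Fin dx → ℝ) :=
  (∑ ω ∈ R.sample k, P.real {ω} * (π ω ⬝ᵥ D.r ω),
    -∑ ω ∈ R.sample k, P.real {ω} • ((D.T ω)ᵀ *ᵥ π ω))

/-- The collection of affine functions at the end of iteration `k`: the rescaled older ones and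
the new ones generated at the candidate and at the incumbent. -/
def Trace.cuts (R : Trace Ω dx m) : ℕ → Set (ℝ × (Fin dx → ℝ))
  | 0 => ∅
  | k + 1 => (fun l => R.θ (k + 1) • l) '' R.cuts k ∪
      {R.cut D (k + 1) (R.candDist (k + 1)) (R.candDual (k + 1)),
        R.cut D (k + 1) (R.incDist (k + 1)) (R.incDual (k + 1))}

/-- The approximation `f^k` of the first-stage objective; `f^0 = 0`. -/
def Trace.model (R : Trace Ω dx m) : ℕ → (Fin dx → ℝ) → ℝ
  | 0, _ => 0
  | k + 1, x => D.c ⬝ᵥ x + sSup ((fun l => l.1 + l.2 ⬝ᵥ x) '' R.cuts D (k + 1))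

/-- `π` is an admissible choice of dual vectors at the point `x` in iteration `k`: an optimal dual
vertex for the newest outcome, and a best vector in `Π^k` for every other observed outcome. -/
def Trace.IsDualChoice (R : Trace Ω dx m) (k : ℕ) (x : Fin dx → ℝ) (π : Ω → Fin m → ℝ) : Prop :=
  D.IsOptimalDualVertex x (R.obs k) (π (R.obs k)) ∧
    ∀ ω ∈ R.sample k, ω ≠ R.obs k →
      π ω ∈ R.dualSet k ∧ IsMaxOn (D.dualValue x ω) (R.dualSet k) (π ω)

/-- `P` solves the distribution separation problem at the point `x` in iteration `k`. -/
def Trace.IsExtremal (R : Trace Ω dx m) (k : ℕ) (x : Fin dx → ℝ) (P : Measure Ω) : Prop :=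
  P ∈ R.approxSet k ∧ IsMaxOn (R.separationValue D k x) (R.approxSet k) P

open Classical in
/-- `R` is a (non-terminated) run of the distributionally robust stochastic decomposition method
with incumbent update parameter `γ`. -/
structure Trace.IsRun (R : Trace Ω dx m) (γ : ℝ) : Prop where
  approxSet_prob : ∀ k, 1 ≤ k → ∀ P ∈ R.approxSet k, IsProbabilityMeasure P
  approxSet_sample : ∀ k, 1 ≤ k → ∀ P ∈ R.approxSet k, P {ω | ω ∉ R.sample k} = 0
  initial_incumbent : R.incumbent 0 ∈ D.feasible
  master_feasible : ∀ k, R.candidate (k + 1) ∈ D.feasible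
  master_optimal : ∀ k, IsMinOn (R.model D k) D.feasible (R.candidate (k + 1))
  candDual_choice : ∀ k, R.IsDualChoice D (k + 1) (R.candidate (k + 1)) (R.candDual (k + 1))
  incDual_choice : ∀ k, R.IsDualChoice D (k + 1) (R.incumbent k) (R.incDual (k + 1))
  candDist_extremal : ∀ k, R.IsExtremal D (k + 1) (R.candidate (k + 1)) (R.candDist (k + 1))
  incDist_extremal : ∀ k, R.IsExtremal D (k + 1) (R.incumbent k) (R.incDist (k + 1))
  incumbent_update : ∀ k, R.incumbent (k + 1) =
    if R.model D (k + 1) (R.candidate (k + 1)) - R.model D (k + 1) (R.incumbent k)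
        < γ * (R.model D k (R.candidate (k + 1)) - R.model D k (R.incumbent k))
    then R.candidate (k + 1) else R.incumbent k

/-- In every iteration `k ≥ 2` the map `Θ^k` with the factor `θ^k ∈ [0, 1]` that the
run uses sends the previous approximate ambiguity set into the current one. -/
def Trace.ThetaInvariant (R : Trace Ω dx m) : Prop :=
  ∀ k, 1 ≤ k → R.θ (k + 1) ∈ Set.Icc (0 : ℝ) 1 ∧
    ∀ P ∈ R.approxSet k, Theta (R.θ (k + 1)) (R.obs (k + 1)) P ∈ R.approxSet (k + 1)

/-- Sequential sampling of a random run: the outcomes are independent with common law `μ`, and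
each is generated only after the current candidate and incumbent have been determined. The σ-algebra
`𝒢 k` is the information available after iteration `k`. The initial sample consists of
points of the support of `μ`. -/
structure IsSequentialSampling [TopologicalSpace Ω] {S : Type*} {mS : MeasurableSpace S}
    (ν : Measure S) (𝒢 : Filtration ℕ mS) (μ : Measure Ω) (R : S → Trace Ω dx m) : Prop where
  init_support : ∀ s, ∀ ω ∈ (R s).init, ω ∈ μ.support
  obs_measurable : ∀ k, Measurable[𝒢 (k + 1)] (fun s => (R s).obs (k + 1))
  obs_law : ∀ k, Measure.map (fun s => (R s).obs (k + 1)) ν = μ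
  obs_indep : ∀ k,
    Indep (MeasurableSpace.comap (fun s => (R s).obs (k + 1)) inferInstance) (𝒢 k) ν
  candidate_measurable : ∀ k, Measurable[𝒢 k] (fun s => (R s).candidate (k + 1))
  incumbent_measurable : ∀ k, Measurable[𝒢 k] (fun s => (R s).incumbent k)

end Algorithm

end

end DRSD

/-!
The recourse cost `Q(x, ω)` is by strong duality a maximum of dual values over the compact
polyhedron `Π`, so it is Lipschitz in `x`, uniformly in `ω`, and continuous in `ω`; the same
moduli hold for the approximations `Q^k` (`Problem.HasBounds`).

*The models are asymptotic minorants.* Every cut of iteration `k` lies below `z ↦ E_P[Q(z, ·)]`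
for some `P` in the approximate ambiguity set: rescaling by `θ^k` is compensated by applying `Θ^k`
to `P`, because `Q ≥ 0` (`Trace.IsRun.exists_cut_le`). Convergence of the ambiguity sets makes the
worst-case expectations converge uniformly on the feasible region
(`Trace.IsRun.eventually_abs_approxWorstCase_sub_le`), whence `f^k ≤ f + o(1)`.

*New cuts are asymptotically exact where they are generated.* The outcome `ω^k` is independent of
the past, which determines `x^k` and the incumbent. By the conditional Borel–Cantelli lemma,
almost surely every accumulation point of the candidates (or incumbents) and every point of the
support of `μ` are approached simultaneously, infinitely often (`ae_mapClusterPt_prodMk`). At the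
pairs `(x^k, ω^k)` the approximation `Q^k` is exact, the error `Q - Q^k` decreases in `k` and is
equicontinuous, so its supremum over the support, taken at `x^k`, tends to zero
(`Trace.IsRun.eventually_recourse_le_approxRecourse_add`). No finiteness of the set of dual
vertices is needed.

*Descent.* If the incumbent values stayed above the optimal value by some `ε > 0`, the decrease
predicted by the model would stay bounded away from zero; each update realizes a fixed fraction of
it, so only finitely many updates could occur. On the other hand, among sufficiently many
consecutive candidates two are close to each other, by compactness, and the cut generated at the
first of them has lost almost nothing at the second, because `θ^k → 1` and the number of
iterations in between is bounded. The model is then nearly exact at the second candidate, the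
realized decrease nearly equals the predicted one, and since `γ < 1` an update takes place, a
contradiction (`frequently_incumbent_le`).
-/

namespace DRSD

/-! ### Linear programming duality -/

section Duality

variable {m n : ℕ} {W : Matrix (Fin m) (Fin n) ℝ} {g : Fin n → ℝ}

lemma dotProduct_mulVec_le {π : Fin m → ℝ} (hπ : Wᵀ *ᵥ π ≤ g) {y : Fin n → ℝ} (hy : 0 ≤ y) :
    π ⬝ᵥ W *ᵥ y ≤ g ⬝ᵥ y := by
  rw [dotProduct_mulVec, ← mulVec_transpose]
  exact dotProduct_le_dotProduct_of_nonneg_right hπ hy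

lemma exists_dotProduct_eq (f : (Fin m → ℝ) →ₗ[ℝ] ℝ) : ∃ π : Fin m → ℝ, ∀ h, f h = π ⬝ᵥ h := by
  refine ⟨fun i => f (fun j => if i = j then 1 else 0), fun h => ?_⟩
  rw [LinearMap.pi_apply_eq_sum_univ f h, dotProduct]
  exact Finset.sum_congr rfl fun i _ => by rw [smul_eq_mul, mul_comm]

/-- If the dual feasible region is non-empty and bounded, then the cone spanned by the columns of
`W` is the whole space: otherwise a separating functional would be a recession direction of the
dual feasible region. -/
lemma exists_nonneg_mulVec_eq (hne : {π : Fin m → ℝ | Wᵀ *ᵥ π ≤ g}.Nonempty)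
    (hbd : Bornology.IsBounded {π : Fin m → ℝ | Wᵀ *ᵥ π ≤ g}) (h : Fin m → ℝ) :
    ∃ y : Fin n → ℝ, 0 ≤ y ∧ W *ᵥ y = h := by
  set K : Set (Fin m → ℝ) := (fun y => W *ᵥ y) '' {y : Fin n → ℝ | 0 ≤ y} with hK
  have hconv : Convex ℝ K :=
    (convex_Ici (0 : Fin n → ℝ)).linear_image W.mulVecLin
  have hsmul : ∀ t : ℝ, 0 ≤ t → ∀ k ∈ K, t • k ∈ K := by
    rintro t ht _ ⟨y, hy, rfl⟩
    replace hy : 0 ≤ y := hy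
    exact ⟨t • y, show 0 ≤ t • y from smul_nonneg ht hy, by simp [mulVec_smul]⟩
  have h0 : (0 : Fin m → ℝ) ∈ K := ⟨0, le_refl (0 : Fin n → ℝ), by simp⟩
  have hdense : closure K = Set.univ := by
    refine Set.eq_univ_of_forall fun v => ?_
    by_contra hv
    obtain ⟨f, u, hfu, huv⟩ := geometric_hahn_banach_closed_point hconv.closure isClosed_closure hv
    have hfK : ∀ k ∈ K, f k ≤ 0 := by
      intro k hk
      by_contra! hpos
      have hu : 0 < u := by simpa using hfu 0 (subset_closure h0)
      have := hfu _ (subset_closure (hsmul (u / f k) (by positivity) k hk))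
      rw [map_smul, smul_eq_mul, div_mul_cancel₀ _ hpos.ne'] at this
      exact this.false
    have hfv : 0 < f v := lt_trans (by simpa using hfu 0 (subset_closure h0)) huv
    obtain ⟨ρ, hρ⟩ := exists_dotProduct_eq (f : (Fin m → ℝ) →ₗ[ℝ] ℝ)
    have hρ' : ∀ h, f h = ρ ⬝ᵥ h := hρ
    have hWρ : Wᵀ *ᵥ ρ ≤ 0 := by
      intro j
      have h1 := hfK (W *ᵥ Pi.single j 1)
        ⟨Pi.single j 1, Pi.single_nonneg.2 zero_le_one, rfl⟩
      rw [hρ', dotProduct_mulVec, ← mulVec_transpose, dotProduct_single, mul_one] at h1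
      simpa using h1
    obtain ⟨π₀, hπ₀⟩ := hne
    obtain ⟨C, hC⟩ := hbd.exists_norm_le
    have hρ0 : ρ ≠ 0 := by rintro rfl; rw [hρ'] at hfv; simp at hfv
    have hρn : 0 < ‖ρ‖ := norm_pos_iff.2 hρ0
    have hC0 : 0 ≤ C := (norm_nonneg _).trans (hC π₀ hπ₀)
    -- far along the ray `π₀ + t ρ` the norm exceeds `C`
    set t : ℝ := (2 * C + 1) / ‖ρ‖ with ht
    have ht0 : 0 ≤ t := by positivity
    have hmem : Wᵀ *ᵥ (π₀ + t • ρ) ≤ g := by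
      intro j
      have h1 := hπ₀ j
      have h2 := mul_nonpos_of_nonneg_of_nonpos ht0 (hWρ j)
      simp only [mulVec_add, mulVec_smul, Pi.add_apply, Pi.smul_apply, smul_eq_mul]
      linarith
    have h1 := hC _ hmem
    have h2 := hC _ hπ₀
    have h3 : ‖t • ρ‖ ≤ ‖π₀ + t • ρ‖ + ‖π₀‖ := by
      simpa using norm_sub_le (π₀ + t • ρ) π₀
    rw [norm_smul, Real.norm_of_nonneg ht0, ht, div_mul_cancel₀ _ hρn.ne'] at h3
    linarith
  -- a dense convex set in finite dimension has interior points, hence is the whole space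
  have hspan : affineSpan ℝ K = ⊤ := by
    have hcl : IsClosed (affineSpan ℝ K : Set (Fin m → ℝ)) :=
      AffineSubspace.closed_of_finiteDimensional _
    have := closure_minimal (subset_affineSpan ℝ K) hcl
    rw [hdense] at this
    exact SetLike.coe_injective (by simpa using this)
  have hint : (interior K).Nonempty := hconv.interior_nonempty_iff_affineSpan_eq_top.2 hspan
  have := hconv.interior_closure_eq_interior_of_nonempty_interior hint
  rw [hdense, interior_univ] at this
  obtain ⟨y, hy, hyh⟩ := interior_subset (this ▸ Set.mem_univ h : h ∈ interior K)
  exact ⟨y, hy, hyh⟩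

/-- Strong duality. The value function of the linear program, as a function of its right-hand side,
is finite and sublinear, so by Hahn–Banach it has at every point a supporting linear functional;
such functionals are dual feasible. -/
theorem exists_dual_eq_sInf (hne : {π : Fin m → ℝ | Wᵀ *ᵥ π ≤ g}.Nonempty)
    (hbd : Bornology.IsBounded {π : Fin m → ℝ | Wᵀ *ᵥ π ≤ g}) (h : Fin m → ℝ) :
    ∃ π : Fin m → ℝ, Wᵀ *ᵥ π ≤ g ∧
      sInf ((fun y => g ⬝ᵥ y) '' {y : Fin n → ℝ | W *ᵥ y = h ∧ 0 ≤ y}) = π ⬝ᵥ h := by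
  set q : (Fin m → ℝ) → ℝ :=
    fun h => sInf ((fun y => g ⬝ᵥ y) '' {y : Fin n → ℝ | W *ᵥ y = h ∧ 0 ≤ y}) with hq
  obtain ⟨π₀, hπ₀⟩ := hne
  have hqle : ∀ y : Fin n → ℝ, 0 ≤ y → q (W *ᵥ y) ≤ g ⬝ᵥ y := by
    intro y hy
    refine csInf_le ⟨π₀ ⬝ᵥ W *ᵥ y, ?_⟩ ⟨y, ⟨rfl, hy⟩, rfl⟩
    rintro _ ⟨y', ⟨hy', hy'0⟩, rfl⟩
    simpa [hy'] using dotProduct_mulVec_le hπ₀ hy'0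
  have hleq : ∀ (h : Fin m → ℝ) (a : ℝ), (∀ y : Fin n → ℝ, 0 ≤ y → W *ᵥ y = h → a ≤ g ⬝ᵥ y) →
      a ≤ q h := by
    intro h a ha
    obtain ⟨y, hy, hyh⟩ := exists_nonneg_mulVec_eq ⟨π₀, hπ₀⟩ hbd h
    refine le_csInf ⟨_, y, ⟨hyh, hy⟩, rfl⟩ ?_
    rintro _ ⟨y', ⟨hy', hy'0⟩, rfl⟩
    exact ha y' hy'0 hy'
  have hadd : ∀ h₁ h₂, q (h₁ + h₂) ≤ q h₁ + q h₂ := by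
    intro h₁ h₂
    rw [← sub_le_iff_le_add']
    refine hleq _ _ fun y₂ hy₂ e₂ => ?_
    rw [sub_le_iff_le_add', ← sub_le_iff_le_add]
    refine hleq _ _ fun y₁ hy₁ e₁ => ?_
    rw [sub_le_iff_le_add, ← dotProduct_add, ← e₁, ← e₂, ← mulVec_add]
    exact hqle _ (add_nonneg hy₁ hy₂)
  have hhom' : ∀ c : ℝ, 0 < c → ∀ h, q (c • h) ≤ c * q h := by
    intro c hc h
    rw [← div_le_iff₀' hc]
    refine hleq _ _ fun y hy e => ?_
    rw [div_le_iff₀' hc, ← e, ← mulVec_smul, ← smul_eq_mul, ← dotProduct_smul]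
    exact hqle _ (smul_nonneg hc.le hy)
  have hhom : ∀ c : ℝ, 0 < c → ∀ h, q (c • h) = c * q h := by
    intro c hc h
    refine le_antisymm (hhom' c hc h) ?_
    have := hhom' c⁻¹ (inv_pos.2 hc) (c • h)
    rwa [inv_smul_smul₀ hc.ne', inv_mul_eq_div, le_div_iff₀' hc] at this
  have hq0 : q 0 = 0 := by
    have := hhom 2 two_pos 0
    rw [smul_zero] at this
    linarith
  by_cases hh : h = 0
  · subst hh
    exact ⟨π₀, hπ₀, by rw [dotProduct_zero]; exact hq0⟩
  obtain ⟨f, hf, hfq⟩ := exists_extension_of_le_sublinear (LinearPMap.mkSpanSingleton h (q h) hh) q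
    hhom hadd (by
      rintro ⟨x, hx⟩
      obtain ⟨c, rfl⟩ := Submodule.mem_span_singleton.1 hx
      rw [LinearPMap.mkSpanSingleton'_apply, smul_eq_mul]
      change c * q h ≤ q (c • h)
      rcases lt_trichotomy c 0 with hc | rfl | hc
      · have h1 := hadd (c • h) ((-c) • h)
        rw [hhom (-c) (neg_pos.2 hc), ← add_smul, add_neg_cancel, zero_smul, hq0] at h1
        linarith
      · simp [hq0]
      · exact (hhom c hc h).ge)
  obtain ⟨π, hπ⟩ := exists_dotProduct_eq f
  refine ⟨π, fun j => ?_, ?_⟩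
  · have h1 := (hfq (W *ᵥ Pi.single j 1)).trans (hqle _ (Pi.single_nonneg.2 zero_le_one))
    rwa [hπ, dotProduct_mulVec, ← mulVec_transpose, dotProduct_single, mul_one, dotProduct_single,
      mul_one] at h1
  · rw [← hπ]
    have h1 := hf ⟨h, Submodule.mem_span_singleton_self h⟩
    have h2 := LinearPMap.mkSpanSingleton_apply ℝ ℝ (σ := RingHom.id ℝ) hh (q h)
    exact (h1.trans h2).symm

end Duality

/-! ### Moduli of the recourse cost -/

section Recourse

variable {Ω : Type*} [TopologicalSpace Ω] [MeasurableSpace Ω] {dx m₁ dy m : ℕ}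
  {D : Problem Ω dx m₁ dy m}

lemma Problem.StandingAssumptions.exists_recourse_eq (hD : D.StandingAssumptions)
    (x : Fin dx → ℝ) (ω : Ω) : ∃ π ∈ D.dualFeasible, D.recourse x ω = D.dualValue x ω π :=
  exists_dual_eq_sInf hD.dual_nonempty hD.dual_compact.isBounded _

lemma Problem.StandingAssumptions.dualValue_le_recourse (hD : D.StandingAssumptions)
    {π : Fin m → ℝ} (hπ : π ∈ D.dualFeasible) (x : Fin dx → ℝ) (ω : Ω) :
    D.dualValue x ω π ≤ D.recourse x ω := by
  obtain ⟨y, hy, e⟩ := exists_nonneg_mulVec_eq hD.dual_nonempty hD.dual_compact.isBounded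
    (D.r ω - D.T ω *ᵥ x)
  refine le_csInf ⟨_, y, ⟨e, hy⟩, rfl⟩ ?_
  rintro _ ⟨y', ⟨hy', hy'0⟩, rfl⟩
  have := dotProduct_mulVec_le hπ hy'0
  rwa [hy'] at this

lemma Problem.StandingAssumptions.recourse_eq_dualValue (hD : D.StandingAssumptions)
    {π : Fin m → ℝ} {x : Fin dx → ℝ} {ω : Ω} (hπ : D.IsOptimalDualVertex x ω π) :
    D.recourse x ω = D.dualValue x ω π := by
  refine le_antisymm ?_ (hD.dualValue_le_recourse (extremePoints_subset hπ.1) x ω)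
  obtain ⟨π', hπ', e⟩ := hD.exists_recourse_eq x ω
  exact e.trans_le (hπ.2 hπ')

/-- Uniform constants for the dual objectives of all vectors in `Π ∪ {0}`: `M` is a Lipschitz
constant in the right-hand side `r(ω) - T(ω) x`, `L` is a Lipschitz constant in the first-stage
decision, and `B` bounds the values over the first-stage feasible region. -/
structure Problem.HasBounds (D : Problem Ω dx m₁ dy m) (M L B : ℝ) : Prop where
  M_nonneg : 0 ≤ M
  L_nonneg : 0 ≤ L
  B_nonneg : 0 ≤ B
  modulus : ∀ π ∈ insert 0 D.dualFeasible, ∀ x x' ω ω', |D.dualValue x ω π - D.dualValue x' ω' π| ≤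
    M * ‖(D.r ω - D.T ω *ᵥ x) - (D.r ω' - D.T ω' *ᵥ x')‖
  lipschitz : ∀ π ∈ insert 0 D.dualFeasible, ∀ x x' ω,
    |D.dualValue x ω π - D.dualValue x' ω π| ≤ L * ‖x - x'‖
  bound : ∀ π ∈ insert 0 D.dualFeasible, ∀ x ∈ D.feasible, ∀ ω, |D.dualValue x ω π| ≤ B

lemma abs_dotProduct_le {n : ℕ} (v w : Fin n → ℝ) : |v ⬝ᵥ w| ≤ (∑ i, |v i|) * ‖w‖ := by
  rw [dotProduct, Finset.sum_mul]
  refine (Finset.abs_sum_le_sum_abs _ _).trans (Finset.sum_le_sum fun i _ => ?_)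
  rw [abs_mul]
  exact mul_le_mul_of_nonneg_left (norm_le_pi_norm w i) (abs_nonneg _)

lemma Problem.StandingAssumptions.continuous_rhs (hD : D.StandingAssumptions) :
    Continuous fun p : (Fin dx → ℝ) × Ω => D.r p.2 - D.T p.2 *ᵥ p.1 :=
  (hD.continuous_r.comp continuous_snd).sub
    ((hD.continuous_T.comp continuous_snd).matrix_mulVec continuous_fst)

lemma _root_.IsCompact.exists_forall_le {X : Type*} [TopologicalSpace X] {s : Set X}
    (hs : IsCompact s) {f : X → ℝ} (hf : Continuous f) : ∃ C, 0 ≤ C ∧ ∀ x ∈ s, f x ≤ C := by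
  obtain ⟨C, hC⟩ := hs.bddAbove_image hf.continuousOn
  exact ⟨max C 0, le_max_right _ _, fun x hx => (hC ⟨x, hx, rfl⟩).trans (le_max_left _ _)⟩

lemma Problem.StandingAssumptions.exists_hasBounds [CompactSpace Ω] (hD : D.StandingAssumptions) :
    ∃ M L B, D.HasBounds M L B := by
  obtain ⟨M, hM0, hM⟩ := (hD.dual_compact.insert 0).exists_forall_le
    (f := fun π : Fin m → ℝ => ∑ i, |π i|) (by fun_prop)
  obtain ⟨K, hK0, hK⟩ := (isCompact_univ (X := Ω)).exists_forall_le
    (f := fun ω => ∑ i, ∑ j, |D.T ω i j|) (by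
      refine continuous_finsetSum _ fun i _ => continuous_finsetSum _ fun j _ => ?_
      exact (hD.continuous_T.matrix_elem i j).abs)
  obtain ⟨H, hH0, hH⟩ := (hD.feasible_compact.prod (isCompact_univ (X := Ω))).exists_forall_le
    hD.continuous_rhs.norm
  have hmod : ∀ π ∈ insert 0 D.dualFeasible, ∀ x x' ω ω',
      |D.dualValue x ω π - D.dualValue x' ω' π| ≤
        M * ‖(D.r ω - D.T ω *ᵥ x) - (D.r ω' - D.T ω' *ᵥ x')‖ := by
    intro π hπ x x' ω ω'
    rw [Problem.dualValue, Problem.dualValue, ← dotProduct_sub]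
    exact (abs_dotProduct_le _ _).trans (mul_le_mul_of_nonneg_right (hM π hπ) (norm_nonneg _))
  refine ⟨M, M * K, M * H, hM0, by positivity, by positivity, hmod, ?_, ?_⟩
  · intro π hπ x x' ω
    refine (hmod π hπ x x' ω ω).trans ?_
    rw [sub_sub_sub_cancel_left, ← mulVec_sub, mul_assoc, norm_sub_rev x x']
    refine mul_le_mul_of_nonneg_left ?_ hM0
    refine (pi_norm_le_iff_of_nonneg (by positivity)).2 fun i => ?_
    refine (abs_dotProduct_le _ _).trans (mul_le_mul_of_nonneg_right ?_ (norm_nonneg _))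
    exact (Finset.single_le_sum (f := fun i => ∑ j, |D.T ω i j|)
      (fun i _ => Finset.sum_nonneg fun j _ => abs_nonneg _) (Finset.mem_univ i)).trans
        (hK ω trivial)
  · intro π hπ x hx ω
    exact (abs_dotProduct_le _ _).trans
      (mul_le_mul (hM π hπ) (hH (x, ω) ⟨hx, trivial⟩) (norm_nonneg _) hM0)

variable {M L B : ℝ}

lemma Problem.StandingAssumptions.recourse_sub_le_modulus (hD : D.StandingAssumptions)
    (hb : D.HasBounds M L B) (x x' : Fin dx → ℝ) (ω ω' : Ω) :
    D.recourse x ω - D.recourse x' ω' ≤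
      M * ‖(D.r ω - D.T ω *ᵥ x) - (D.r ω' - D.T ω' *ᵥ x')‖ := by
  obtain ⟨π, hπ, e⟩ := hD.exists_recourse_eq x ω
  have h1 := (abs_le.1 (hb.modulus π (Or.inr hπ) x x' ω ω')).2
  have h2 := hD.dualValue_le_recourse hπ x' ω'
  linarith

lemma Problem.StandingAssumptions.recourse_sub_le (hD : D.StandingAssumptions)
    (hb : D.HasBounds M L B) (x x' : Fin dx → ℝ) (ω : Ω) :
    D.recourse x ω - D.recourse x' ω ≤ L * ‖x - x'‖ := by
  obtain ⟨π, hπ, e⟩ := hD.exists_recourse_eq x ω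
  have h1 := (abs_le.1 (hb.lipschitz π (Or.inr hπ) x x' ω)).2
  have h2 := hD.dualValue_le_recourse hπ x' ω
  linarith

lemma Problem.StandingAssumptions.recourse_le (hD : D.StandingAssumptions)
    (hb : D.HasBounds M L B) {x : Fin dx → ℝ} (hx : x ∈ D.feasible) (ω : Ω) :
    D.recourse x ω ≤ B := by
  obtain ⟨π, hπ, e⟩ := hD.exists_recourse_eq x ω
  exact e.trans_le (abs_le.1 (hb.bound π (Or.inr hπ) x hx ω)).2

lemma Problem.StandingAssumptions.continuous_recourse (hD : D.StandingAssumptions)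
    (hb : D.HasBounds M L B) (x : Fin dx → ℝ) : Continuous (D.recourse x) := by
  refine continuous_iff_continuousAt.2 fun ω₀ => ?_
  rw [ContinuousAt, tendsto_iff_norm_sub_tendsto_zero]
  have hc : Continuous fun ω =>
      M * ‖(D.r ω - D.T ω *ᵥ x) - (D.r ω₀ - D.T ω₀ *ᵥ x)‖ :=
    continuous_const.mul ((hD.continuous_rhs.comp (Continuous.prodMk_right x)).sub
      continuous_const).norm
  have ht := hc.tendsto ω₀
  rw [sub_self, norm_zero, mul_zero] at ht
  refine squeeze_zero (fun _ => norm_nonneg _) (fun ω => ?_) ht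
  refine abs_sub_le_iff.2 ⟨hD.recourse_sub_le_modulus hb x x ω ω₀, ?_⟩
  rw [norm_sub_rev]
  exact hD.recourse_sub_le_modulus hb x x ω₀ ω

end Recourse

/-! ### Expectations under finitely supported distributions -/

section FiniteSupport

variable {Ω : Type*} [MeasurableSpace Ω] [MeasurableSingletonClass Ω]

lemma integrable_of_finset_support {P : Measure Ω} [IsFiniteMeasure P] {s : Finset Ω}
    (hP : P {ω | ω ∉ s} = 0) (f : Ω → ℝ) : Integrable f P := by
  have hr : P.restrict s = P := Measure.restrict_eq_self_of_ae_mem hP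
  rw [← hr]
  exact IntegrableOn.finset

lemma integral_eq_sum_of_finset_support {P : Measure Ω} [IsFiniteMeasure P] {s : Finset Ω}
    (hP : P {ω | ω ∉ s} = 0) (f : Ω → ℝ) : ∫ ω, f ω ∂P = ∑ ω ∈ s, P.real {ω} * f ω := by
  have hr : P.restrict s = P := Measure.restrict_eq_self_of_ae_mem hP
  conv_lhs => rw [← hr]
  rw [setIntegral_finset (hf := IntegrableOn.finset)]
  rfl

lemma sum_real_singleton_eq_one {P : Measure Ω} [IsProbabilityMeasure P] {s : Finset Ω}
    (hP : P {ω | ω ∉ s} = 0) : ∑ ω ∈ s, P.real {ω} = 1 := by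
  simpa using (integral_eq_sum_of_finset_support hP fun _ => 1).symm

lemma abs_sum_real_singleton_mul_le {P : Measure Ω} [IsProbabilityMeasure P] {s : Finset Ω}
    (hP : P {ω | ω ∉ s} = 0) {f : Ω → ℝ} {C : ℝ} (hf : ∀ ω ∈ s, |f ω| ≤ C) :
    |∑ ω ∈ s, P.real {ω} * f ω| ≤ C := by
  refine (Finset.abs_sum_le_sum_abs _ _).trans ?_
  calc ∑ ω ∈ s, |P.real {ω} * f ω| ≤ ∑ ω ∈ s, P.real {ω} * C := by
        refine Finset.sum_le_sum fun ω hω => ?_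
        rw [abs_mul, abs_of_nonneg measureReal_nonneg]
        exact mul_le_mul_of_nonneg_left (hf ω hω) measureReal_nonneg
    _ = C := by rw [← Finset.sum_mul, sum_real_singleton_eq_one hP, one_mul]

end FiniteSupport

/-! ### Elementary properties of a run -/

section Trace

variable {Ω : Type*} [MeasurableSpace Ω] {dx m₁ dy m : ℕ}
  {D : Problem Ω dx m₁ dy m} {R : Trace Ω dx m} {γ M L B : ℝ}

lemma Trace.dualSet_finite (R : Trace Ω dx m) (k : ℕ) : (R.dualSet k).Finite := by
  induction k with
  | zero => exact Set.finite_singleton _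
  | succ k ih => exact ih.union ((Set.finite_singleton _).insert _)

lemma Trace.zero_mem_dualSet (R : Trace Ω dx m) (k : ℕ) : 0 ∈ R.dualSet k := by
  induction k with
  | zero => exact rfl
  | succ k ih => exact Or.inl ih

lemma Trace.dualSet_mono (R : Trace Ω dx m) : Monotone R.dualSet :=
  monotone_nat_of_le_succ fun _ _ => Or.inl

lemma Trace.IsRun.dualSet_subset (hR : R.IsRun D γ) (k : ℕ) :
    R.dualSet k ⊆ insert 0 D.dualFeasible := by
  induction k with
  | zero => rintro _ rfl; exact Or.inl rfl
  | succ k ih =>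
    rintro π (h | rfl | rfl)
    · exact ih h
    · exact Or.inr (extremePoints_subset (hR.candDual_choice k).1.1)
    · exact Or.inr (extremePoints_subset (hR.incDual_choice k).1.1)

lemma Trace.dualValue_le_approxRecourse (D : Problem Ω dx m₁ dy m) (R : Trace Ω dx m) {k : ℕ}
    {π : Fin m → ℝ} (hπ : π ∈ R.dualSet k) (x : Fin dx → ℝ) (ω : Ω) :
    D.dualValue x ω π ≤ R.approxRecourse D k x ω :=
  le_csSup ((R.dualSet_finite k).image _).bddAbove ⟨π, hπ, rfl⟩

lemma Trace.exists_approxRecourse_eq (D : Problem Ω dx m₁ dy m) (R : Trace Ω dx m) (k : ℕ)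
    (x : Fin dx → ℝ) (ω : Ω) :
    ∃ π ∈ R.dualSet k, R.approxRecourse D k x ω = D.dualValue x ω π := by
  obtain ⟨π, hπ, e⟩ := Set.Nonempty.csSup_mem
    (Set.Nonempty.image (D.dualValue x ω) ⟨0, R.zero_mem_dualSet k⟩)
    ((R.dualSet_finite k).image _)
  exact ⟨π, hπ, e.symm⟩

lemma Trace.approxRecourse_mono (D : Problem Ω dx m₁ dy m) (R : Trace Ω dx m) (x : Fin dx → ℝ)
    (ω : Ω) : Monotone fun k => R.approxRecourse D k x ω := by
  intro j k hjk
  obtain ⟨π, hπ, e⟩ := R.exists_approxRecourse_eq D j x ω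
  exact e.trans_le (R.dualValue_le_approxRecourse D (R.dualSet_mono hjk hπ) x ω)

lemma Trace.IsRun.approxRecourse_sub_le (hR : R.IsRun D γ) (hb : D.HasBounds M L B) (k : ℕ)
    (x x' : Fin dx → ℝ) (ω ω' : Ω) :
    R.approxRecourse D k x ω - R.approxRecourse D k x' ω' ≤
      M * ‖(D.r ω - D.T ω *ᵥ x) - (D.r ω' - D.T ω' *ᵥ x')‖ := by
  obtain ⟨π, hπ, e⟩ := R.exists_approxRecourse_eq D k x ω
  have h1 := (abs_le.1 (hb.modulus π (hR.dualSet_subset k hπ) x x' ω ω')).2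
  have h2 := R.dualValue_le_approxRecourse D hπ x' ω'
  linarith

lemma Trace.IsRun.incumbent_succ (hR : R.IsRun D γ) (k : ℕ) :
    R.incumbent (k + 1) = R.candidate (k + 1) ∨ R.incumbent (k + 1) = R.incumbent k := by
  rw [hR.incumbent_update k]
  split_ifs
  · exact Or.inl rfl
  · exact Or.inr rfl

lemma Trace.IsRun.incumbent_mem (hR : R.IsRun D γ) (k : ℕ) : R.incumbent k ∈ D.feasible := by
  induction k with
  | zero => exact hR.initial_incumbent
  | succ k ih =>
    rcases hR.incumbent_succ k with h | h <;> rw [h]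
    exacts [hR.master_feasible k, ih]

lemma Trace.sample_subset {s : Set Ω} (h0 : ∀ ω ∈ R.init, ω ∈ s) (h : ∀ k, R.obs (k + 1) ∈ s)
    (k : ℕ) : ∀ ω ∈ R.sample k, ω ∈ s := by
  classical
  induction k with
  | zero => exact h0
  | succ k ih =>
    intro ω hω
    rw [Trace.sample] at hω
    rcases Finset.mem_insert.1 hω with rfl | hω
    exacts [h k, ih ω hω]

lemma Trace.cuts_finite (D : Problem Ω dx m₁ dy m) (R : Trace Ω dx m) (k : ℕ) :
    (R.cuts D k).Finite := by
  induction k with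
  | zero => exact Set.finite_empty
  | succ k ih => exact (ih.image _).union ((Set.finite_singleton _).insert _)

lemma Trace.cut_eval (D : Problem Ω dx m₁ dy m) (R : Trace Ω dx m) (k : ℕ) (P : Measure Ω)
    (π : Ω → Fin m → ℝ) (z : Fin dx → ℝ) :
    (R.cut D k P π).1 + (R.cut D k P π).2 ⬝ᵥ z =
      ∑ ω ∈ R.sample k, P.real {ω} * D.dualValue z ω (π ω) := by
  simp only [Trace.cut, neg_dotProduct, sum_dotProduct, smul_dotProduct, smul_eq_mul]
  rw [← sub_eq_add_neg, ← Finset.sum_sub_distrib]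
  refine Finset.sum_congr rfl fun ω _ => ?_
  rw [Problem.dualValue, dotProduct_sub, dotProduct_mulVec, mulVec_transpose, mul_sub]

/-- Every dual vector used in a cut is dual feasible or zero. -/
lemma Trace.IsRun.mem_of_isDualChoice (hR : R.IsRun D γ) {k : ℕ} {x : Fin dx → ℝ}
    {π : Ω → Fin m → ℝ} (hπ : R.IsDualChoice D k x π) {ω : Ω} (hω : ω ∈ R.sample k) :
    π ω ∈ insert 0 D.dualFeasible := by
  by_cases h : ω = R.obs k
  · subst h
    exact Or.inr (extremePoints_subset hπ.1.1)
  · exact hR.dualSet_subset k (hπ.2 ω hω h).1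

/-- Worst-case expected recourse cost over the approximate ambiguity set of iteration `k`. -/
noncomputable def Trace.approxWorstCase (D : Problem Ω dx m₁ dy m) (R : Trace Ω dx m) (k : ℕ)
    (x : Fin dx → ℝ) : ℝ :=
  sSup ((fun P : Measure Ω => ∫ ω, D.recourse x ω ∂P) '' R.approxSet k)

lemma Trace.IsRun.approxSet_nonempty (hR : R.IsRun D γ) (k : ℕ) : (R.approxSet (k + 1)).Nonempty :=
  ⟨_, (hR.candDist_extremal k).1⟩

/-- After `n` iterations a cut survives with a factor `t`; losses of at most `η` per iteration add
up to at most `n * η`. -/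
lemma Trace.exists_smul_mem_cuts (D : Problem Ω dx m₁ dy m) {j : ℕ} {l : ℝ × (Fin dx → ℝ)}
    (hl : l ∈ R.cuts D j) {η : ℝ} (hθ : ∀ i, j < i → R.θ i ∈ Set.Icc (0 : ℝ) 1 ∧ 1 - η ≤ R.θ i)
    (n : ℕ) : ∃ t ∈ Set.Icc (0 : ℝ) 1, 1 - n * η ≤ t ∧ t • l ∈ R.cuts D (j + n) := by
  induction n with
  | zero => exact ⟨1, by simp, by simp, by simpa using hl⟩
  | succ n ih =>
    obtain ⟨t, ⟨h0, h1⟩, h, hmem⟩ := ih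
    obtain ⟨⟨h0', h1'⟩, h'⟩ := hθ (j + n + 1) (by omega)
    refine ⟨R.θ (j + n + 1) * t, ⟨mul_nonneg h0' h0, mul_le_one₀ h1' h0 h1⟩, ?_,
      Or.inl ⟨t • l, hmem, smul_smul _ _ _⟩⟩
    push_cast
    nlinarith

end Trace

/-! ### New cuts -/

section Cut

variable {Ω : Type*} [MeasurableSpace Ω] {dx m₁ dy m : ℕ}
  {D : Problem Ω dx m₁ dy m} {R : Trace Ω dx m} {γ M L B : ℝ} [MeasurableSingletonClass Ω]

lemma Trace.IsRun.integral_eq_sum (hR : R.IsRun D γ) {k : ℕ} {P : Measure Ω}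
    (hP : P ∈ R.approxSet (k + 1)) (f : Ω → ℝ) :
    ∫ ω, f ω ∂P = ∑ ω ∈ R.sample (k + 1), P.real {ω} * f ω := by
  have := hR.approxSet_prob (k + 1) k.succ_pos P hP
  exact integral_eq_sum_of_finset_support (hR.approxSet_sample (k + 1) k.succ_pos P hP) f

lemma Trace.IsRun.integrable (hR : R.IsRun D γ) {k : ℕ} {P : Measure Ω}
    (hP : P ∈ R.approxSet (k + 1)) (f : Ω → ℝ) : Integrable f P := by
  have := hR.approxSet_prob (k + 1) k.succ_pos P hP
  exact integrable_of_finset_support (hR.approxSet_sample (k + 1) k.succ_pos P hP) f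

lemma Trace.IsRun.integral_le (hR : R.IsRun D γ) {k : ℕ} {P : Measure Ω}
    (hP : P ∈ R.approxSet (k + 1)) {f : Ω → ℝ} {C : ℝ} (hf : ∀ ω, f ω ≤ C) :
    ∫ ω, f ω ∂P ≤ C := by
  have := hR.approxSet_prob (k + 1) k.succ_pos P hP
  calc ∫ ω, f ω ∂P ≤ ∫ _, C ∂P := integral_mono (hR.integrable hP f) (integrable_const C) hf
    _ = C := by simp

lemma Trace.IsRun.abs_newCut_le (hR : R.IsRun D γ) (hb : D.HasBounds M L B) {k : ℕ}
    {x z : Fin dx → ℝ} {P : Measure Ω} {π : Ω → Fin m → ℝ} (hP : P ∈ R.approxSet (k + 1))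
    (hπ : R.IsDualChoice D (k + 1) x π) (hz : z ∈ D.feasible) :
    |(R.cut D (k + 1) P π).1 + (R.cut D (k + 1) P π).2 ⬝ᵥ z| ≤ B := by
  have := hR.approxSet_prob (k + 1) k.succ_pos P hP
  rw [R.cut_eval]
  exact abs_sum_real_singleton_mul_le (hR.approxSet_sample (k + 1) k.succ_pos P hP)
    fun ω hω => hb.bound _ (hR.mem_of_isDualChoice hπ hω) z hz ω

lemma Trace.IsRun.newCut_sub_le (hR : R.IsRun D γ) (hb : D.HasBounds M L B) {k : ℕ}
    {x : Fin dx → ℝ} {P : Measure Ω} {π : Ω → Fin m → ℝ} (hP : P ∈ R.approxSet (k + 1))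
    (hπ : R.IsDualChoice D (k + 1) x π) (z z' : Fin dx → ℝ) :
    ((R.cut D (k + 1) P π).1 + (R.cut D (k + 1) P π).2 ⬝ᵥ z) -
      ((R.cut D (k + 1) P π).1 + (R.cut D (k + 1) P π).2 ⬝ᵥ z') ≤ L * ‖z - z'‖ := by
  have := hR.approxSet_prob (k + 1) k.succ_pos P hP
  rw [R.cut_eval, R.cut_eval, ← Finset.sum_sub_distrib]
  simp only [← mul_sub]
  exact (le_abs_self _).trans (abs_sum_real_singleton_mul_le
    (hR.approxSet_sample (k + 1) k.succ_pos P hP)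
    fun ω hω => hb.lipschitz _ (hR.mem_of_isDualChoice hπ hω) z z' ω)

end Cut

/-! ### The models as minorants of the approximate worst-case objective -/

section Run

variable {Ω : Type*} [MeasurableSpace Ω] {dx m₁ dy m : ℕ}
  {D : Problem Ω dx m₁ dy m} {R : Trace Ω dx m} {γ M L B : ℝ}
  [TopologicalSpace Ω]

/-- The vector `0` need not be dual feasible; its dual value is nevertheless a lower bound because
the recourse cost is nonnegative. -/
lemma Problem.StandingAssumptions.dualValue_le_recourse_of_mem_insert
    (hD : D.StandingAssumptions) {π : Fin m → ℝ} (hπ : π ∈ insert 0 D.dualFeasible)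
    {x : Fin dx → ℝ} (hx : x ∈ D.feasible) (ω : Ω) : D.dualValue x ω π ≤ D.recourse x ω := by
  rcases hπ with rfl | hπ
  · rw [Problem.dualValue, zero_dotProduct]
    exact hD.recourse_nonneg x hx ω
  · exact hD.dualValue_le_recourse hπ x ω

lemma Trace.IsRun.approxRecourse_le (hR : R.IsRun D γ) (hD : D.StandingAssumptions) (k : ℕ)
    {x : Fin dx → ℝ} (hx : x ∈ D.feasible) (ω : Ω) :
    R.approxRecourse D k x ω ≤ D.recourse x ω := by
  obtain ⟨π, hπ, e⟩ := R.exists_approxRecourse_eq D k x ω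
  exact e.trans_le (hD.dualValue_le_recourse_of_mem_insert (hR.dualSet_subset k hπ) hx ω)

lemma Trace.IsRun.recourse_le_approxRecourse_candidate (hR : R.IsRun D γ)
    (hD : D.StandingAssumptions) (k : ℕ) :
    D.recourse (R.candidate (k + 1)) (R.obs (k + 1)) ≤
      R.approxRecourse D (k + 1) (R.candidate (k + 1)) (R.obs (k + 1)) := by
  rw [hD.recourse_eq_dualValue (hR.candDual_choice k).1]
  exact R.dualValue_le_approxRecourse D (Or.inr (Or.inl rfl)) _ _

lemma Trace.IsRun.recourse_le_approxRecourse_incumbent (hR : R.IsRun D γ)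
    (hD : D.StandingAssumptions) (k : ℕ) :
    D.recourse (R.incumbent k) (R.obs (k + 1)) ≤
      R.approxRecourse D (k + 1) (R.incumbent k) (R.obs (k + 1)) := by
  rw [hD.recourse_eq_dualValue (hR.incDual_choice k).1]
  exact R.dualValue_le_approxRecourse D (Or.inr (Or.inr rfl)) _ _

/-- The vectors used in a cut are at least as good, at the point of the cut, as all discovered
dual vectors. -/
lemma Trace.IsRun.approxRecourse_le_dualValue (hR : R.IsRun D γ) (hD : D.StandingAssumptions)
    {k : ℕ} {x : Fin dx → ℝ} (hx : x ∈ D.feasible) {π : Ω → Fin m → ℝ}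
    (hπ : R.IsDualChoice D k x π) {ω : Ω} (hω : ω ∈ R.sample k) :
    R.approxRecourse D k x ω ≤ D.dualValue x ω (π ω) := by
  by_cases h : ω = R.obs k
  · subst h
    rw [← hD.recourse_eq_dualValue hπ.1]
    exact hR.approxRecourse_le hD k hx _
  · obtain ⟨ρ, hρ, e⟩ := R.exists_approxRecourse_eq D k x ω
    exact e.trans_le ((hπ.2 ω hω h).2 hρ)

variable [MeasurableSingletonClass Ω]

lemma Trace.IsRun.integral_recourse_le_approxWorstCase (hR : R.IsRun D γ)
    (hD : D.StandingAssumptions) (hb : D.HasBounds M L B) {k : ℕ} {P : Measure Ω}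
    (hP : P ∈ R.approxSet (k + 1)) {x : Fin dx → ℝ} (hx : x ∈ D.feasible) :
    ∫ ω, D.recourse x ω ∂P ≤ R.approxWorstCase D (k + 1) x := by
  refine le_csSup ⟨B, ?_⟩ ⟨P, hP, rfl⟩
  rintro _ ⟨P', hP', rfl⟩
  exact hR.integral_le hP' (hD.recourse_le hb hx)

lemma Trace.IsRun.approxWorstCase_sub_le (hR : R.IsRun D γ)
    (hD : D.StandingAssumptions) (hb : D.HasBounds M L B) (k : ℕ) {x x' : Fin dx → ℝ}
    (hx' : x' ∈ D.feasible) :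
    R.approxWorstCase D (k + 1) x - R.approxWorstCase D (k + 1) x' ≤ L * ‖x - x'‖ := by
  rw [sub_le_iff_le_add]
  refine csSup_le ((hR.approxSet_nonempty k).image _) ?_
  rintro _ ⟨P, hP, rfl⟩
  have h1 := hR.integral_recourse_le_approxWorstCase hD hb hP hx'
  have h2 := hR.integral_le hP (f := fun ω => D.recourse x ω - D.recourse x' ω)
    (hD.recourse_sub_le hb x x')
  rw [integral_sub (hR.integrable hP _) (hR.integrable hP _)] at h2
  dsimp only
  linarith

/-- A new cut lies below the expected recourse cost under the distribution defining it. -/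
lemma Trace.IsRun.newCut_le (hR : R.IsRun D γ) (hD : D.StandingAssumptions) {k : ℕ}
    {x z : Fin dx → ℝ} {P : Measure Ω} {π : Ω → Fin m → ℝ} (hP : P ∈ R.approxSet (k + 1))
    (hπ : R.IsDualChoice D (k + 1) x π) (hz : z ∈ D.feasible) :
    (R.cut D (k + 1) P π).1 + (R.cut D (k + 1) P π).2 ⬝ᵥ z ≤ ∫ ω, D.recourse z ω ∂P := by
  rw [R.cut_eval, hR.integral_eq_sum hP]
  refine Finset.sum_le_sum fun ω hω => mul_le_mul_of_nonneg_left ?_ measureReal_nonneg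
  exact hD.dualValue_le_recourse_of_mem_insert (hR.mem_of_isDualChoice hπ hω) hz ω

/-- Every cut, old or new, lies below the expected recourse cost under some member of the current
approximate ambiguity set. For a rescaled cut this member is obtained by applying `Θ`; the mass
it adds at the newest outcome is harmless since recourse costs are nonnegative. -/
lemma Trace.IsRun.exists_cut_le (hR : R.IsRun D γ) (hD : D.StandingAssumptions)
    (hΘ : R.ThetaInvariant) (k : ℕ) : ∀ l ∈ R.cuts D (k + 1), ∃ P ∈ R.approxSet (k + 1),
      ∀ z ∈ D.feasible, l.1 + l.2 ⬝ᵥ z ≤ ∫ ω, D.recourse z ω ∂P := by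
  induction k with
  | zero =>
    rintro l (⟨l', hl', -⟩ | rfl | rfl)
    · exact hl'.elim
    · exact ⟨_, (hR.candDist_extremal 0).1,
        fun z hz => hR.newCut_le hD (hR.candDist_extremal 0).1 (hR.candDual_choice 0) hz⟩
    · exact ⟨_, (hR.incDist_extremal 0).1,
        fun z hz => hR.newCut_le hD (hR.incDist_extremal 0).1 (hR.incDual_choice 0) hz⟩
  | succ k ih =>
    rintro l (⟨l', hl', rfl⟩ | rfl | rfl)
    · obtain ⟨P, hP, hle⟩ := ih l' hl'
      obtain ⟨⟨hθ0, hθ1⟩, hmem⟩ := hΘ (k + 1) k.succ_pos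
      refine ⟨_, hmem P hP, fun z hz => ?_⟩
      have hQ := hD.recourse_nonneg z hz (R.obs (k + 1 + 1))
      have hi := hR.integrable hP (D.recourse z)
      have hd : Integrable (D.recourse z) (Measure.dirac (R.obs (k + 1 + 1))) :=
        integrable_dirac (by simp [enorm])
      rw [Theta, integral_add_measure (hi.smul_measure ENNReal.ofReal_ne_top)
        (hd.smul_measure ENNReal.ofReal_ne_top), integral_smul_measure, integral_smul_measure,
        integral_dirac, ENNReal.toReal_ofReal hθ0, ENNReal.toReal_ofReal (sub_nonneg.2 hθ1)]
      have h1 := mul_le_mul_of_nonneg_left (hle z hz) hθ0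
      have h2 := mul_nonneg (sub_nonneg.2 hθ1) hQ
      simp only [Prod.smul_fst, Prod.smul_snd, smul_eq_mul, smul_dotProduct]
      linarith
    · exact ⟨_, (hR.candDist_extremal _).1,
        fun z hz => hR.newCut_le hD (hR.candDist_extremal _).1 (hR.candDual_choice _) hz⟩
    · exact ⟨_, (hR.incDist_extremal _).1,
        fun z hz => hR.newCut_le hD (hR.incDist_extremal _).1 (hR.incDual_choice _) hz⟩

lemma Trace.IsRun.model_le (hR : R.IsRun D γ) (hD : D.StandingAssumptions)
    (hb : D.HasBounds M L B) (hΘ : R.ThetaInvariant) (k : ℕ) {z : Fin dx → ℝ}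
    (hz : z ∈ D.feasible) :
    R.model D (k + 1) z ≤ D.c ⬝ᵥ z + R.approxWorstCase D (k + 1) z := by
  have hne : (R.cuts D (k + 1)).Nonempty := ⟨_, Or.inr (Or.inl rfl)⟩
  refine add_le_add le_rfl (csSup_le (hne.image _) ?_)
  rintro _ ⟨l, hl, rfl⟩
  obtain ⟨P, hP, hle⟩ := hR.exists_cut_le hD hΘ k l hl
  exact (hle z hz).trans (hR.integral_recourse_le_approxWorstCase hD hb hP hz)

/-- At the point where it is generated, a new cut is as accurate as the approximation of the
recourse costs by the discovered dual vectors. -/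
lemma Trace.IsRun.approxWorstCase_sub_le_newCut (hR : R.IsRun D γ) (hD : D.StandingAssumptions)
    {k : ℕ} {x : Fin dx → ℝ} {P : Measure Ω} {π : Ω → Fin m → ℝ}
    (hP : R.IsExtremal D (k + 1) x P) (hπ : R.IsDualChoice D (k + 1) x π) (hx : x ∈ D.feasible)
    {ε : ℝ} (hε : ∀ ω ∈ R.sample (k + 1), D.recourse x ω ≤ R.approxRecourse D (k + 1) x ω + ε) :
    R.approxWorstCase D (k + 1) x - ε ≤
      (R.cut D (k + 1) P π).1 + (R.cut D (k + 1) P π).2 ⬝ᵥ x := by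
  rw [sub_le_iff_le_add]
  refine csSup_le ((hR.approxSet_nonempty k).image _) ?_
  rintro _ ⟨P', hP', rfl⟩
  have := hR.approxSet_prob (k + 1) k.succ_pos P' hP'
  have hs : R.separationValue D (k + 1) x P ≤
      (R.cut D (k + 1) P π).1 + (R.cut D (k + 1) P π).2 ⬝ᵥ x := by
    rw [R.cut_eval]
    exact Finset.sum_le_sum fun ω hω => mul_le_mul_of_nonneg_left
      (hR.approxRecourse_le_dualValue hD hx hπ hω) measureReal_nonneg
  have hm : R.separationValue D (k + 1) x P' ≤ R.separationValue D (k + 1) x P := hP.2 hP'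
  have h1 : ∑ ω ∈ R.sample (k + 1), P'.real {ω} * D.recourse x ω ≤
      ∑ ω ∈ R.sample (k + 1), P'.real {ω} * (R.approxRecourse D (k + 1) x ω + ε) :=
    Finset.sum_le_sum fun ω hω => mul_le_mul_of_nonneg_left (hε ω hω) measureReal_nonneg
  simp only [mul_add, Finset.sum_add_distrib, ← Finset.sum_mul] at h1
  rw [sum_real_singleton_eq_one (hR.approxSet_sample (k + 1) k.succ_pos P' hP'), one_mul] at h1
  rw [Trace.separationValue] at hm
  dsimp only
  rw [hR.integral_eq_sum hP']
  linarith

/-- A cut generated at `x` in iteration `j = k + 1` is still present, up to a rescaling by a factor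
close to one, a bounded number `n` of iterations later; it bounds the model from below near `x`. -/
lemma Trace.IsRun.le_model_add (hR : R.IsRun D γ) (hD : D.StandingAssumptions)
    (hb : D.HasBounds M L B) {k : ℕ} {x : Fin dx → ℝ} {P : Measure Ω} {π : Ω → Fin m → ℝ}
    (hP : R.IsExtremal D (k + 1) x P) (hπ : R.IsDualChoice D (k + 1) x π) (hx : x ∈ D.feasible)
    (hmem : R.cut D (k + 1) P π ∈ R.cuts D (k + 1))
    {ε : ℝ} (hε : ∀ ω ∈ R.sample (k + 1), D.recourse x ω ≤ R.approxRecourse D (k + 1) x ω + ε)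
    {η : ℝ} (hθ : ∀ i, k + 1 < i → R.θ i ∈ Set.Icc (0 : ℝ) 1 ∧ 1 - η ≤ R.θ i)
    (n : ℕ) {z : Fin dx → ℝ} (hz : z ∈ D.feasible) :
    D.c ⬝ᵥ z + R.approxWorstCase D (k + 1) x - L * ‖x - z‖ - ε - n * η * B ≤
      R.model D (k + 1 + n) z := by
  obtain ⟨t, ⟨ht0, ht1⟩, ht, htmem⟩ := R.exists_smul_mem_cuts D hmem hθ n
  have h1 := hR.approxWorstCase_sub_le_newCut hD hP hπ hx hε
  have h2 := hR.newCut_sub_le hb hP.1 hπ x z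
  have h3 := abs_le.1 (hR.abs_newCut_le hb hP.1 hπ hz)
  set l := R.cut D (k + 1) P π
  have h4 : D.c ⬝ᵥ z + ((t • l).1 + (t • l).2 ⬝ᵥ z) ≤ R.model D (k + 1 + n) z := by
    rw [show k + 1 + n = k + n + 1 by omega] at htmem ⊢
    have hbdd : BddAbove ((fun l => l.1 + l.2 ⬝ᵥ z) '' R.cuts D (k + n + 1)) :=
      ((R.cuts_finite D (k + n + 1)).image _).bddAbove
    have := le_csSup hbdd ⟨_, htmem, rfl⟩
    exact add_le_add_right this _
  simp only [Prod.smul_fst, Prod.smul_snd, smul_eq_mul, smul_dotProduct] at h4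
  have h5 : (1 - t) * (l.1 + l.2 ⬝ᵥ z) ≤ n * η * B :=
    (mul_le_mul_of_nonneg_left h3.2 (sub_nonneg.2 ht1)).trans
      (mul_le_mul_of_nonneg_right (by linarith) hb.B_nonneg)
  linarith

end Run

/-! ### Recurrence of independent draws -/

section Recurrence

variable {S : Type*} {mS : MeasurableSpace S} {ν : Measure S} [IsProbabilityMeasure ν]
  {𝒢 : Filtration ℕ mS} {E Ω : Type*} [MeasurableSpace E] [MeasurableSpace Ω] {μ : Measure Ω}
  {Y : ℕ → S → E} {Z : ℕ → S → Ω}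

/-- If `Y k` is known before `Z k` is drawn and `Y k` visits `V` infinitely often, then infinitely
many of these visits are accompanied by a draw in `U`, whenever `U` has positive probability. This
is Lévy's conditional Borel–Cantelli lemma: the conditional probability of a joint visit is
`μ U` on the event `Y k ∈ V`. -/
lemma ae_frequently_mem_and_mem (hY : ∀ k, Measurable[𝒢 k] (Y k))
    (hZ : ∀ k, Measurable[𝒢 (k + 1)] (Z k)) (hlaw : ∀ k, Measure.map (Z k) ν = μ)
    (hind : ∀ k, Indep (MeasurableSpace.comap (Z k) inferInstance) (𝒢 k) ν)
    {V : Set E} (hV : MeasurableSet V) {U : Set Ω} (hU : MeasurableSet U) (hμU : μ U ≠ 0) :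
    ∀ᵐ s ∂ν, (∃ᶠ k in atTop, Y k s ∈ V) → ∃ᶠ k in atTop, Y k s ∈ V ∧ Z k s ∈ U := by
  let A : ℕ → Set S
    | 0 => ∅
    | k + 1 => Y k ⁻¹' V ∩ Z k ⁻¹' U
  have hA : ∀ n, MeasurableSet[𝒢 n] (A n) := by
    rintro (_ | k)
    · exact @MeasurableSet.empty _ (𝒢 0)
    · exact (𝒢.mono k.le_succ _ (hY k hV)).inter (hZ k hU)
  have hp : 0 < (μ U).toReal := by
    have : IsFiniteMeasure μ := hlaw 0 ▸ inferInstance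
    exact ENNReal.toReal_pos hμU (measure_ne_top _ _)
  have hcond : ∀ k, ν[(A (k + 1)).indicator (1 : S → ℝ) | 𝒢 k] =ᵐ[ν]
      (Y k ⁻¹' V).indicator fun _ => (μ U).toReal := by
    intro k
    have hZm : Measurable (Z k) := (hZ k).mono (𝒢.le _) le_rfl
    have hUm : MeasurableSet (Z k ⁻¹' U) := hZm hU
    have h1 : (A (k + 1)).indicator (1 : S → ℝ) =
        (Y k ⁻¹' V).indicator ((Z k ⁻¹' U).indicator 1) := (Set.indicator_indicator _ _ _).symm
    rw [h1]
    refine (condExp_indicator ((integrable_const (1 : ℝ)).indicator hUm) (hY k hV)).trans ?_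
    have h2 : ν[(Z k ⁻¹' U).indicator (1 : S → ℝ) | 𝒢 k] =ᵐ[ν] fun _ => (μ U).toReal := by
      refine (condExp_indep_eq hZm.comap_le (𝒢.le k) ?_ (hind k)).trans (Eventually.of_forall ?_)
      · have hUc : MeasurableSet[MeasurableSpace.comap (Z k) inferInstance] (Z k ⁻¹' U) :=
          ⟨U, hU, rfl⟩
        exact stronglyMeasurable_one.indicator hUc
      · intro _
        simp only
        rw [integral_indicator_one hUm, ← hlaw k, Measure.map_apply hZm hU, Measure.real]
    filter_upwards [h2] with s hs
    by_cases hsV : s ∈ Y k ⁻¹' V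
    · rw [Set.indicator_of_mem hsV, Set.indicator_of_mem hsV]
      exact hs
    · rw [Set.indicator_of_notMem hsV, Set.indicator_of_notMem hsV]
  filter_upwards [ae_mem_limsup_atTop_iff ν hA, ae_all_iff.2 hcond] with s hs hc hfreq
  have h1 : Tendsto (fun n => ∑ k ∈ Finset.range n,
      (Y k ⁻¹' V).indicator (fun _ => (μ U).toReal) s) atTop atTop := by
    have h2 : s ∈ limsup (fun k => Y k ⁻¹' V) atTop := mem_limsup_iff_frequently_mem.2 hfreq
    rwa [Set.limsup_eq_tendsto_sum_indicator_atTop hp] at h2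
  have h3 : s ∈ limsup A atTop := hs.2 (by simpa only [hc] using h1)
  rw [mem_limsup_iff_frequently_mem, frequently_atTop] at h3
  refine frequently_atTop.2 fun a => ?_
  obtain ⟨b, hb, hmem⟩ := h3 (a + 1)
  obtain ⟨k, rfl⟩ : ∃ k, b = k + 1 := ⟨b - 1, by omega⟩
  exact ⟨k, by omega, hmem⟩

/-- Almost surely every accumulation point of `Y`, paired with any point of the support of the
law of the draws, is an accumulation point of the joint sequence. -/
theorem ae_mapClusterPt_prodMk [TopologicalSpace E] [SecondCountableTopology E] [BorelSpace E]
    [TopologicalSpace Ω] [SecondCountableTopology Ω] [BorelSpace Ω]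
    (hY : ∀ k, Measurable[𝒢 k] (Y k))
    (hZ : ∀ k, Measurable[𝒢 (k + 1)] (Z k)) (hlaw : ∀ k, Measure.map (Z k) ν = μ)
    (hind : ∀ k, Indep (MeasurableSpace.comap (Z k) inferInstance) (𝒢 k) ν) :
    ∀ᵐ s ∂ν, ∀ x, ∀ ω ∈ μ.support, MapClusterPt x atTop (fun k => Y k s) →
      MapClusterPt (x, ω) atTop fun k => (Y k s, Z k s) := by
  have hbE := TopologicalSpace.isBasis_countableBasis E
  have hbΩ := TopologicalSpace.isBasis_countableBasis Ω
  have key : ∀ᵐ s ∂ν, ∀ V ∈ TopologicalSpace.countableBasis E,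
      ∀ U ∈ TopologicalSpace.countableBasis Ω, μ U ≠ 0 →
        (∃ᶠ k in atTop, Y k s ∈ V) → ∃ᶠ k in atTop, Y k s ∈ V ∧ Z k s ∈ U := by
    rw [ae_ball_iff (TopologicalSpace.countable_countableBasis E)]
    intro V hV
    rw [ae_ball_iff (TopologicalSpace.countable_countableBasis Ω)]
    intro U hU
    by_cases h : μ U = 0
    · exact Eventually.of_forall fun s hs => (hs h).elim
    · filter_upwards [ae_frequently_mem_and_mem hY hZ hlaw hind (hbE.isOpen hV).measurableSet
        (hbΩ.isOpen hU).measurableSet h] with s hs _ using hs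
  filter_upwards [key] with s hs x ω hω hx
  rw [mapClusterPt_iff_frequently]
  intro N hN
  obtain ⟨V', hV', U', hU', hsub⟩ := mem_nhds_prod_iff.1 hN
  obtain ⟨V, hV, hxV, hVV'⟩ := hbE.mem_nhds_iff.1 hV'
  obtain ⟨U, hU, hωU, hUU'⟩ := hbΩ.mem_nhds_iff.1 hU'
  have hμU : μ U ≠ 0 :=
    (Measure.mem_support_iff_forall ω |>.1 hω U ((hbΩ.isOpen hU).mem_nhds hωU)).ne'
  have hfreq := mapClusterPt_iff_frequently.1 hx V ((hbE.isOpen hV).mem_nhds hxV)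
  exact (hs V hV U hU hμU hfreq).mono fun k hk => hsub ⟨hVV' hk.1, hUU' hk.2⟩

end Recurrence

/-! ### Asymptotic exactness of the recourse approximations -/

section Gap

variable {Ω : Type*} [MetricSpace Ω] [CompactSpace Ω] [MeasurableSpace Ω] {dx m₁ dy m : ℕ}
  {D : Problem Ω dx m₁ dy m} {R : Trace Ω dx m} {γ M L B : ℝ}

/-- Along a sequence of points at which the recourse costs of the newest outcomes are evaluated
exactly, the approximation of the recourse costs becomes exact uniformly over the support. If the
error stayed above `ε` near an accumulation point `(x, ω)`, some earlier exact evaluation close to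
`(x, ω)` would contradict it, since errors decrease in `k` and are equicontinuous. -/
lemma Trace.IsRun.eventually_recourse_le_approxRecourse_add (hR : R.IsRun D γ)
    (hD : D.StandingAssumptions) (hb : D.HasBounds M L B) {Y : ℕ → Fin dx → ℝ}
    (hY : ∀ k, Y k ∈ D.feasible)
    (hexact : ∀ k, D.recourse (Y k) (R.obs (k + 1)) ≤
      R.approxRecourse D (k + 1) (Y k) (R.obs (k + 1)))
    {K : Set Ω} (hK : IsClosed K)
    (hrec : ∀ x, ∀ ω ∈ K, MapClusterPt x atTop Y →
      MapClusterPt (x, ω) atTop fun k => (Y k, R.obs (k + 1)))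
    {ε : ℝ} (hε : 0 < ε) :
    ∀ᶠ k in atTop, ∀ ω ∈ K, D.recourse (Y k) ω ≤ R.approxRecourse D (k + 1) (Y k) ω + ε := by
  by_contra hcon
  obtain ⟨φ, hφ, hφ'⟩ := extraction_of_frequently_atTop (not_eventually.1 hcon)
  push Not at hφ'
  choose w hwK hw using hφ'
  obtain ⟨⟨x, ω⟩, ⟨-, hω⟩, hcl⟩ :=
    (hD.feasible_compact.prod hK.isCompact).exists_mapClusterPt_of_frequently (l := atTop)
      (f := fun n => (Y (φ n), w n)) (Frequently.of_forall fun n => ⟨hY _, hwK n⟩)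
  have hx : MapClusterPt x atTop Y :=
    (hcl.continuousAt_comp (f := Prod.fst) continuous_fst.continuousAt).of_comp hφ.tendsto_atTop
  set H : (Fin dx → ℝ) × Ω → Fin m → ℝ := fun p => D.r p.2 - D.T p.2 *ᵥ p.1 with hH
  have hHc : Continuous H := hD.continuous_rhs
  have hN : ∀ᶠ p in 𝓝 (x, ω), M * ‖H p - H (x, ω)‖ < ε / 4 := by
    have hc : Continuous fun p => M * ‖H p - H (x, ω)‖ :=
      continuous_const.mul (hHc.sub continuous_const).norm
    refine hc.tendsto (x, ω) (Iio_mem_nhds ?_)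
    simp only [sub_self, norm_zero, mul_zero]
    positivity
  obtain ⟨j, hj⟩ := (mapClusterPt_iff_frequently.1 (hrec x ω hω hx) _ hN).exists
  obtain ⟨n, hn, hjn⟩ := ((mapClusterPt_iff_frequently.1 hcl _ hN).and_eventually
    (hφ.tendsto_atTop.eventually_ge_atTop j)).exists
  have hj' : M * ‖H (Y j, R.obs (j + 1)) - H (x, ω)‖ < ε / 4 := hj
  have hn' : M * ‖H (Y (φ n), w n) - H (x, ω)‖ < ε / 4 := hn
  have hclose : M * ‖H (Y (φ n), w n) - H (Y j, R.obs (j + 1))‖ ≤ ε / 2 := by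
    have h1 := mul_le_mul_of_nonneg_left
      (norm_sub_le_norm_sub_add_norm_sub (H (Y (φ n), w n)) (H (x, ω)) (H (Y j, R.obs (j + 1))))
      hb.M_nonneg
    rw [norm_sub_rev (H (x, ω)), mul_add] at h1
    linarith
  have h1 := hD.recourse_sub_le_modulus hb (Y (φ n)) (Y j) (w n) (R.obs (j + 1))
  have h2 := hR.approxRecourse_sub_le hb (j + 1) (Y j) (Y (φ n)) (R.obs (j + 1)) (w n)
  rw [norm_sub_rev] at h2
  have h3 := R.approxRecourse_mono D (Y (φ n)) (w n) (show j + 1 ≤ φ n + 1 by omega)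
  have h4 := hw n
  have h5 := hexact j
  dsimp only [hH] at hclose h3
  linarith

end Gap

/-! ### Convergence of the worst-case expectations -/

section Ambiguity

variable {Ω : Type*} [MeasurableSpace Ω]

/-- Control of expectations by the distance extends from `𝓕` to linear combinations of its members
and constants. Both measures being probability measures, constants contribute nothing. -/
lemma edist_integral_le_of_mem_span {𝓕 : Set (Ω → ℝ)} {h : Ω → ℝ}
    (hh : h ∈ Submodule.span ℝ (insert 1 𝓕)) :
    ∃ C : NNReal, ∀ P P' : Measure Ω, IsProbabilityMeasure P → IsProbabilityMeasure P' →
      (∀ F ∈ 𝓕, Integrable F P) → (∀ F ∈ 𝓕, Integrable F P') →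
      Integrable h P ∧ Integrable h P' ∧
        edist (∫ ω, h ω ∂P) (∫ ω, h ω ∂P') ≤ C * zetaDist 𝓕 P P' := by
  induction hh using Submodule.span_induction with
  | mem h hmem =>
    rcases hmem with rfl | hmem
    · refine ⟨0, fun P P' _ _ _ _ => ⟨integrable_const 1, integrable_const 1, ?_⟩⟩
      simp
    · refine ⟨1, fun P P' _ _ hP hP' => ⟨hP h hmem, hP' h hmem, ?_⟩⟩
      rw [ENNReal.coe_one, one_mul]
      exact le_iSup₂ (f := fun F (_ : F ∈ 𝓕) => edist (∫ ω, F ω ∂P) (∫ ω, F ω ∂P')) h hmem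
  | zero => exact ⟨0, fun P P' _ _ _ _ => ⟨integrable_zero _ _ _, integrable_zero _ _ _, by simp⟩⟩
  | add f g _ _ ihf ihg =>
    obtain ⟨C, hC⟩ := ihf
    obtain ⟨C', hC'⟩ := ihg
    refine ⟨C + C', fun P P' iP iP' hP hP' => ?_⟩
    obtain ⟨h1, h2, h3⟩ := hC P P' iP iP' hP hP'
    obtain ⟨h1', h2', h3'⟩ := hC' P P' iP iP' hP hP'
    refine ⟨h1.add h1', h2.add h2', ?_⟩
    simp only [Pi.add_apply]
    rw [integral_add h1 h1', integral_add h2 h2', ENNReal.coe_add, add_mul]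
    exact (edist_add_add_le _ _ _ _).trans (add_le_add h3 h3')
  | smul a f _ ih =>
    obtain ⟨C, hC⟩ := ih
    refine ⟨‖a‖₊ * C, fun P P' iP iP' hP hP' => ?_⟩
    obtain ⟨h1, h2, h3⟩ := hC P P' iP iP' hP hP'
    refine ⟨h1.smul a, h2.smul a, ?_⟩
    simp only [Pi.smul_apply]
    rw [integral_smul, integral_smul, edist_smul₀, ENNReal.coe_mul, mul_assoc]
    exact mul_le_mul_right h3 _

lemma exists_zetaDist_lt_of_hausdorffDist_lt {𝓕 : Set (Ω → ℝ)} {𝔓 𝔔 : Set (Measure Ω)} {δ : ℝ≥0∞}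
    (h : hausdorffDist 𝓕 𝔓 𝔔 < δ) :
    (∀ P ∈ 𝔓, ∃ P' ∈ 𝔔, zetaDist 𝓕 P P' < δ) ∧ ∀ P' ∈ 𝔔, ∃ P ∈ 𝔓, zetaDist 𝓕 P P' < δ := by
  have aux : ∀ 𝔓 𝔔 : Set (Measure Ω), setDeviation 𝓕 𝔓 𝔔 < δ →
      ∀ P ∈ 𝔔, ∃ P' ∈ 𝔓, zetaDist 𝓕 P P' < δ := by
    intro 𝔓 𝔔 h P hP
    have h1 : ⨅ P' ∈ 𝔓, zetaDist 𝓕 P P' < δ :=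
      (le_iSup₂ (f := fun P (_ : P ∈ 𝔔) => ⨅ P' ∈ 𝔓, zetaDist 𝓕 P P') P hP).trans_lt h
    simpa only [iInf_lt_iff, exists_prop] using h1
  have hcomm : ∀ P P', zetaDist 𝓕 P P' = zetaDist 𝓕 P' P := fun P P' => by
    simp only [zetaDist, edist_comm]
  refine ⟨aux _ _ ((le_max_right _ _).trans_lt h), fun P' hP' => ?_⟩
  obtain ⟨P, hP, hlt⟩ := aux _ _ ((le_max_left _ _).trans_lt h) P' hP'
  exact ⟨P, hP, hcomm P P' ▸ hlt⟩

/-- Pointwise convergence of functions with a common Lipschitz constant on a compact set is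
uniform. -/
lemma eventually_forall_abs_sub_le {E : Type*} [PseudoMetricSpace E] {X : Set E} (hX : IsCompact X)
    {g : ℕ → E → ℝ} {g' : E → ℝ} {L : ℝ} (hL : 0 ≤ L)
    (hg : ∀ k, ∀ x ∈ X, ∀ y ∈ X, g k x - g k y ≤ L * dist x y)
    (hg' : ∀ x ∈ X, ∀ y ∈ X, g' x - g' y ≤ L * dist x y)
    (hp : ∀ x ∈ X, ∀ ε > 0, ∀ᶠ k in atTop, |g k x - g' x| ≤ ε) {ε : ℝ} (hε : 0 < ε) :
    ∀ᶠ k in atTop, ∀ x ∈ X, |g k x - g' x| ≤ ε := by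
  have key : ∀ᶠ k in atTop, ∀ x ∈ X, x ∈ X → |g k x - g' x| ≤ ε := by
    refine hX.induction_on (p := fun s => ∀ᶠ k in atTop, ∀ x ∈ s, x ∈ X → |g k x - g' x| ≤ ε)
      (by simp) (fun s t hst h => h.mono fun k hk x hx => hk x (hst hx)) ?_ ?_
    · intro s t hs ht
      filter_upwards [hs, ht] with k h1 h2 x hx
      exact hx.elim (h1 x) (h2 x)
    · intro x hx
      have hδ : 0 < ε / (3 * (L + 1)) := by positivity
      refine ⟨Metric.ball x (ε / (3 * (L + 1))),
        mem_nhdsWithin_of_mem_nhds (Metric.ball_mem_nhds x hδ), ?_⟩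
      filter_upwards [hp x hx (ε / 3) (by positivity)] with k hk y hy hyX
      have hd : L * dist y x ≤ ε / 3 := by
        have h1 : dist y x ≤ ε / (3 * (L + 1)) := (Metric.mem_ball.1 hy).le
        rw [le_div_iff₀ (by positivity)] at h1
        nlinarith [dist_nonneg (x := y) (y := x)]
      have h1 := hg k y hyX x hx
      have h2 := hg k x hx y hyX
      have h3 := hg' y hyX x hx
      have h4 := hg' x hx y hyX
      rw [dist_comm x y] at h2 h4
      rw [abs_le] at hk ⊢
      constructor <;> linarith
  exact key.mono fun k hk x hx => hk x hx hx

variable [TopologicalSpace Ω] [BorelSpace Ω] {dx m₁ dy m : ℕ}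
  {D : Problem Ω dx m₁ dy m} {R : Trace Ω dx m} {γ M L B : ℝ}

lemma Problem.StandingAssumptions.integrable_recourse (hD : D.StandingAssumptions)
    (hb : D.HasBounds M L B) {x : Fin dx → ℝ} (hx : x ∈ D.feasible) (P : Measure Ω)
    [IsFiniteMeasure P] : Integrable (D.recourse x) P := by
  refine Integrable.of_bound (hD.continuous_recourse hb x).measurable.aestronglyMeasurable B
    (Eventually.of_forall fun ω => ?_)
  rw [Real.norm_of_nonneg (hD.recourse_nonneg x hx ω)]
  exact hD.recourse_le hb hx ω

lemma Problem.StandingAssumptions.integral_recourse_le_worstCase (hD : D.StandingAssumptions)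
    (hb : D.HasBounds M L B) {x : Fin dx → ℝ} (hx : x ∈ D.feasible) {P : Measure Ω}
    (hP : P ∈ D.ambiguity) : ∫ ω, D.recourse x ω ∂P ≤ D.worstCase x := by
  refine le_csSup ⟨B, ?_⟩ ⟨P, hP, rfl⟩
  rintro _ ⟨P', hP', rfl⟩
  have := hD.ambiguity_prob P' hP'
  calc ∫ ω, D.recourse x ω ∂P' ≤ ∫ _, B ∂P' := integral_mono (hD.integrable_recourse hb hx P')
        (integrable_const B) (hD.recourse_le hb hx)
    _ = B := by simp

lemma Problem.StandingAssumptions.worstCase_sub_le (hD : D.StandingAssumptions)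
    (hb : D.HasBounds M L B) {x x' : Fin dx → ℝ} (hx : x ∈ D.feasible) (hx' : x' ∈ D.feasible) :
    D.worstCase x - D.worstCase x' ≤ L * ‖x - x'‖ := by
  rw [sub_le_iff_le_add]
  refine csSup_le (hD.ambiguity_nonempty.image _) ?_
  rintro _ ⟨P, hP, rfl⟩
  have := hD.ambiguity_prob P hP
  have h1 := hD.integral_recourse_le_worstCase hb hx' hP
  have hi := hD.integrable_recourse hb hx P
  have hi' := hD.integrable_recourse hb hx' P
  have h2 : ∫ ω, (D.recourse x ω - D.recourse x' ω) ∂P ≤ ∫ _, L * ‖x - x'‖ ∂P :=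
    integral_mono (hi.sub hi') (integrable_const _) (hD.recourse_sub_le hb x x')
  rw [integral_sub hi hi', integral_const, probReal_univ, one_smul] at h2
  dsimp only
  linarith

lemma Problem.AdmissibleClass.exists_abs_integral_sub_le {𝓕 : Set (Ω → ℝ)}
    (h𝓕 : D.AdmissibleClass 𝓕) (hD : D.StandingAssumptions) (hb : D.HasBounds M L B)
    {x : Fin dx → ℝ} (hx : x ∈ D.feasible) {ε : ℝ} (hε : 0 < ε) :
    ∃ δ : ℝ≥0∞, 0 < δ ∧ ∀ P P' : Measure Ω, IsProbabilityMeasure P → IsProbabilityMeasure P' →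
      (∀ F ∈ 𝓕, Integrable F P) → (∀ F ∈ 𝓕, Integrable F P') → zetaDist 𝓕 P P' < δ →
        |∫ ω, D.recourse x ω ∂P - ∫ ω, D.recourse x ω ∂P'| ≤ ε := by
  obtain ⟨h, hh, happ⟩ := h𝓕.approximates x hx (ε / 3) (by positivity)
  obtain ⟨C, hC⟩ := edist_integral_le_of_mem_span hh
  refine ⟨ENNReal.ofReal (ε / (3 * (C + 1))), ENNReal.ofReal_pos.2 (by positivity),
    fun P P' iP iP' hP hP' hlt => ?_⟩
  obtain ⟨h1, h2, h3⟩ := hC P P' iP iP' hP hP'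
  -- the three errors: replacing `Q(x, ·)` by `h` under `P` and under `P'`, and changing the measure
  have happrox : ∀ P : Measure Ω, IsProbabilityMeasure P → Integrable h P →
      |∫ ω, D.recourse x ω ∂P - ∫ ω, h ω ∂P| ≤ ε / 3 := by
    intro P iP hi
    rw [← integral_sub (hD.integrable_recourse hb hx P) hi]
    simpa using norm_integral_le_of_norm_le_const (μ := P) (C := ε / 3)
      (f := fun ω => D.recourse x ω - h ω) (Eventually.of_forall happ)
  have hmid : |∫ ω, h ω ∂P - ∫ ω, h ω ∂P'| ≤ ε / 3 := by
    rw [← Real.dist_eq, ← ENNReal.ofReal_le_ofReal_iff (by positivity), ← edist_dist]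
    refine h3.trans ((mul_le_mul_right hlt.le _).trans ?_)
    rw [← ENNReal.ofReal_coe_nnreal, ← ENNReal.ofReal_mul C.coe_nonneg]
    refine ENNReal.ofReal_le_ofReal ?_
    rw [mul_div_assoc', div_le_div_iff₀ (by positivity) (by positivity)]
    nlinarith [C.coe_nonneg]
  have h4 := happrox P iP h1
  have h5 := happrox P' iP' h2
  rw [abs_le] at *
  constructor <;> linarith

/-- Convergence of the ambiguity sets in the Hausdorff distance makes the approximate worst-case
expectations converge, uniformly over the first-stage feasible region. -/
lemma Trace.IsRun.eventually_abs_approxWorstCase_sub_le [MeasurableSingletonClass Ω]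
    (hR : R.IsRun D γ) (hD : D.StandingAssumptions)
    (hb : D.HasBounds M L B) {𝓕 : Set (Ω → ℝ)} (h𝓕 : D.AdmissibleClass 𝓕)
    (hH : Tendsto (fun k => hausdorffDist 𝓕 D.ambiguity (R.approxSet k)) atTop (𝓝 0))
    {ε : ℝ} (hε : 0 < ε) : ∀ᶠ k in atTop, ∀ x ∈ D.feasible,
      |R.approxWorstCase D (k + 1) x - D.worstCase x| ≤ ε := by
  refine eventually_forall_abs_sub_le hD.feasible_compact hb.L_nonneg
    (g := fun k => R.approxWorstCase D (k + 1)) (g' := D.worstCase) ?_ ?_ ?_ hε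
  · intro k x _ y hy
    rw [dist_eq_norm]
    exact hR.approxWorstCase_sub_le hD hb k hy
  · intro x hx y hy
    rw [dist_eq_norm]
    exact hD.worstCase_sub_le hb hx hy
  · intro x hx ε hε
    obtain ⟨δ, hδ, hclose⟩ := h𝓕.exists_abs_integral_sub_le hD hb hx hε
    filter_upwards [(tendsto_add_atTop_iff_nat 1).2 hH |>.eventually (gt_mem_nhds hδ)] with k hk
    obtain ⟨hfwd, hbwd⟩ := exists_zetaDist_lt_of_hausdorffDist_lt hk
    have hc : ∀ P ∈ D.ambiguity, ∀ P' ∈ R.approxSet (k + 1), zetaDist 𝓕 P P' < δ →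
        |∫ ω, D.recourse x ω ∂P - ∫ ω, D.recourse x ω ∂P'| ≤ ε := fun P hP P' hP' hlt =>
      hclose P P' (hD.ambiguity_prob P hP) (hR.approxSet_prob (k + 1) k.succ_pos P' hP')
        (fun F hF => h𝓕.integrable F hF P hP) (fun F _ => hR.integrable hP' F) hlt
    rw [abs_le]
    constructor
    · rw [neg_le_sub_iff_le_add]
      refine csSup_le (hD.ambiguity_nonempty.image _) ?_
      rintro _ ⟨P, hP, rfl⟩
      obtain ⟨P', hP', hlt⟩ := hfwd P hP
      have h1 := (abs_le.1 (hc P hP P' hP' hlt)).2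
      have h2 := hR.integral_recourse_le_approxWorstCase hD hb hP' hx
      dsimp only
      linarith
    · rw [sub_le_iff_le_add]
      refine csSup_le ((hR.approxSet_nonempty k).image _) ?_
      rintro _ ⟨P', hP', rfl⟩
      obtain ⟨P, hP, hlt⟩ := hbwd P' hP'
      have h1 := (abs_le.1 (hc P hP P' hP' hlt)).1
      have h2 := hD.integral_recourse_le_worstCase hb hx hP
      dsimp only
      linarith

end Ambiguity

/-! ### Descent of the incumbents -/

section Descent

variable {E : Type*} [PseudoMetricSpace E] {X : Set E}

/-- In a compact set, any sufficiently long finite sequence has two terms close to each other, the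
required length being independent of the sequence. -/
lemma _root_.IsCompact.exists_forall_exists_lt_dist_lt (hX : IsCompact X) {δ : ℝ} (hδ : 0 < δ) :
    ∃ N : ℕ, ∀ x : ℕ → E, (∀ k, x k ∈ X) → ∃ i j, i < j ∧ j ≤ N ∧ dist (x i) (x j) < δ := by
  obtain ⟨t, -, ht, hcov⟩ := hX.finite_cover_balls (half_pos hδ)
  refine ⟨ht.toFinset.card, fun x hx => ?_⟩
  have hc : ∀ k, ∃ c ∈ t, dist (x k) c < δ / 2 := fun k => by
    simpa only [Set.mem_iUnion, Metric.mem_ball, exists_prop] using hcov (hx k)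
  choose c hct hcd using hc
  obtain ⟨i, hi, j, hj, hij, e⟩ := Finset.exists_ne_map_eq_of_card_lt_of_maps_to
    (s := Finset.range (ht.toFinset.card + 1)) (t := ht.toFinset) (f := c) (by simp)
    (fun k _ => ht.mem_toFinset.2 (hct k))
  have hd : dist (x i) (x j) < δ := by
    have h1 := dist_triangle_right (x i) (x j) (c i)
    have h2 := hcd i
    have h3 := hcd j
    rw [← e] at h3
    linarith
  rw [Finset.mem_range] at hi hj
  rcases hij.lt_or_gt with h | h
  · exact ⟨i, j, h, by omega, hd⟩
  · exact ⟨j, i, h, by omega, by rwa [dist_comm]⟩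

/-- The incumbents of a cutting-plane method with sufficient-decrease updates are asymptotically
optimal infinitely often. Here `x k` minimizes the model `F k`, `v k` is the incumbent at that
time, the models are asymptotically minorants of `f`, and the information gathered at `x k`
persists, up to vanishing errors, over any fixed number of later iterations.

If the incumbents stayed `ε` above the value at some `z`, the predicted decrease would be at least
about `ε`; each update would realize a fixed fraction of it, so there would be finitely many
updates. But by compactness some candidate lies arbitrarily close to one found a bounded number of
iterations earlier; there the prediction is nearly exact, and the update test succeeds. -/
theorem frequently_incumbent_le (hX : IsCompact X) {f : E → ℝ} {K : ℝ} (hK : 0 ≤ K)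
    (hf : ∀ x ∈ X, ∀ y ∈ X, f x - f y ≤ K * dist x y) {F : ℕ → E → ℝ} {x v : ℕ → E} {γ : ℝ}
    (hγ₀ : 0 < γ) (hγ₁ : γ < 1) (hx : ∀ k, x k ∈ X) (hv : ∀ k, v k ∈ X)
    (hmin : ∀ k, IsMinOn (F k) X (x k))
    (hstep : ∀ k, F (k + 1) (x k) - F (k + 1) (v k) < γ * (F k (x k) - F k (v k)) ∧
        v (k + 1) = x k ∨
      γ * (F k (x k) - F k (v k)) ≤ F (k + 1) (x k) - F (k + 1) (v k) ∧ v (k + 1) = v k)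
    (hupper : ∀ ε > 0, ∀ᶠ k in atTop, ∀ z ∈ X, F k z ≤ f z + ε)
    (hcand : ∀ ε > 0, ∀ n : ℕ, ∀ᶠ k in atTop, ∀ i ≤ n, ∀ z ∈ X,
      f (x k) - K * dist (x k) z - ε ≤ F (k + 1 + i) z)
    (hinc : ∀ ε > 0, ∀ᶠ k in atTop, f (v k) - ε ≤ F (k + 1) (v k))
    {z : E} (hz : z ∈ X) {ε : ℝ} (hε : 0 < ε) : ∃ᶠ k in atTop, f (v k) ≤ f z + ε := by
  by_contra hcon
  rw [not_frequently] at hcon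
  -- `e` is the tolerance for all vanishing errors
  obtain ⟨e, he0, he1, he2⟩ : ∃ e > 0, 16 * e ≤ γ * ε ∧ 16 * e ≤ (1 - γ) * ε := by
    refine ⟨min (γ * ε) ((1 - γ) * ε) / 16, ?_, ?_, ?_⟩
    · have : 0 < 1 - γ := sub_pos.2 hγ₁
      positivity
    · rw [mul_div_cancel₀ _ (by norm_num)]
      exact min_le_left _ _
    · rw [mul_div_cancel₀ _ (by norm_num)]
      exact min_le_right _ _
  obtain ⟨N, hN⟩ := hX.exists_forall_exists_lt_dist_lt (δ := e / (2 * (K + 1))) (by positivity)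
  have hγε : γ * ε < ε := by nlinarith
  obtain ⟨k₀, hk₀⟩ := eventually_atTop.1
    (hcon.and ((hupper e he0).and ((hcand e he0 N).and (hinc e he0))))
  have hgap : ∀ k, k₀ ≤ k → f z + ε < f (v k) := fun k hk => not_le.1 (hk₀ k hk).1
  have hup : ∀ k, k₀ ≤ k → ∀ z ∈ X, F k z ≤ f z + e := fun k hk => (hk₀ k hk).2.1
  have hlow : ∀ k, k₀ ≤ k → ∀ i ≤ N, ∀ z ∈ X, f (x k) - K * dist (x k) z - e ≤ F (k + 1 + i) z :=
    fun k hk => (hk₀ k hk).2.2.1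
  have hlowv : ∀ k, k₀ ≤ k → f (v k) - e ≤ F (k + 1) (v k) := fun k hk => (hk₀ k hk).2.2.2
  -- the previous model is already accurate at the incumbent
  have hlowv' : ∀ k, k₀ + 1 ≤ k → f (v k) - e ≤ F k (v k) := by
    intro k hk
    obtain ⟨k, rfl⟩ : ∃ l, k = l + 1 := ⟨k - 1, by omega⟩
    rcases hstep k with ⟨-, h⟩ | ⟨-, h⟩ <;> rw [h]
    · simpa using hlow k (by omega) 0 (Nat.zero_le _) (x k) (hx k)
    · exact hlowv k (by omega)
  have hpred : ∀ k, k₀ + 1 ≤ k → F k (x k) - F k (v k) ≤ -ε + 2 * e := by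
    intro k hk
    have h1 : F k (x k) ≤ F k z := hmin k hz
    have h2 := hup k (by omega) z hz
    have h3 := hlowv' k hk
    have h4 := hgap k (by omega)
    linarith
  have hdec : ∀ k, k₀ + 1 ≤ k →
      F (k + 1) (x k) - F (k + 1) (v k) < γ * (F k (x k) - F k (v k)) →
      f (x k) ≤ f (v k) - γ * ε / 2 := by
    intro k hk hlt
    have h1 := hlow k (by omega) 0 (Nat.zero_le _) (x k) (hx k)
    simp only [dist_self, mul_zero, sub_zero, add_zero] at h1
    have h2 := hup (k + 1) (by omega) (v k) (hv k)
    have h3 := mul_le_mul_of_nonneg_left (hpred k hk) hγ₀.le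
    nlinarith
  have hanti : Antitone fun n => f (v (k₀ + 1 + n)) := by
    refine antitone_nat_of_succ_le fun n => ?_
    rw [← add_assoc]
    rcases hstep (k₀ + 1 + n) with ⟨h, e'⟩ | ⟨-, e'⟩ <;> rw [e']
    have h1 := hdec _ (by omega) h
    have : 0 < γ * ε := mul_pos hγ₀ hε
    linarith
  -- incumbent values decrease and are bounded below, so updates, each gaining `γ * ε / 2`, cease
  have hlim : Tendsto (fun n => f (v (k₀ + 1 + n)) - f (v (k₀ + 1 + (n + 1)))) atTop (𝓝 0) := by
    have h1 := tendsto_atTop_ciInf hanti ⟨f z + ε, by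
      rintro _ ⟨n, rfl⟩
      exact (hgap _ (by omega)).le⟩
    simpa using h1.sub ((tendsto_add_atTop_iff_nat 1).2 h1)
  obtain ⟨n₀, hn₀⟩ := eventually_atTop.1
    (hlim.eventually (gt_mem_nhds (show (0 : ℝ) < γ * ε / 2 by positivity)))
  have hnull : ∀ k, k₀ + 1 + n₀ ≤ k →
      γ * (F k (x k) - F k (v k)) ≤ F (k + 1) (x k) - F (k + 1) (v k) := by
    intro k hk
    obtain ⟨n, rfl⟩ : ∃ n, k = k₀ + 1 + n := ⟨k - (k₀ + 1), by omega⟩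
    rcases hstep (k₀ + 1 + n) with ⟨h, e'⟩ | ⟨h, -⟩
    · have h1 := hdec _ (by omega) h
      have h2 := hn₀ n (by omega)
      rw [← add_assoc, e'] at h2
      linarith
    · exact h
  obtain ⟨i, j, hij, hjN, hdist⟩ := hN (fun n => x (k₀ + 1 + n₀ + n)) fun n => hx _
  -- two nearby candidates `x a`, `x b` with `a < b ≤ a + N`: the rejected update at `b` is absurd
  set a := k₀ + 1 + n₀ + i with ha
  set b := k₀ + 1 + n₀ + j with hb
  have hKd : 2 * (K * dist (x a) (x b)) ≤ e := by
    have h1 : dist (x a) (x b) < e / (2 * (K + 1)) := hdist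
    rw [lt_div_iff₀ (by positivity)] at h1
    nlinarith [dist_nonneg (x := x a) (y := x b)]
  have h1 := hlow a (by omega) (b - a - 1) (by omega) (x b) (hx b)
  rw [show a + 1 + (b - a - 1) = b by omega] at h1
  have h2 := hf (x b) (hx b) (x a) (hx a)
  rw [dist_comm] at h2
  have h3 := hnull b (by omega)
  have h4 := hup (b + 1) (by omega) (x b) (hx b)
  have h5 := hlowv b (by omega)
  have h6 := hup b (by omega) (v b) (hv b)
  have h7 := hpred b (by omega)
  have h8 : (1 - γ) * (F b (x b) - F b (v b)) ≤ (1 - γ) * (-ε + 2 * e) :=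
    mul_le_mul_of_nonneg_left h7 (sub_nonneg.2 hγ₁.le)
  nlinarith

/-- If the objective values of a sequence in a compact set come arbitrarily close to the infimum
infinitely often, some subsequence has only minimizers as accumulation points. -/
lemma exists_subseq_mapClusterPt_isMinOn (hX : IsCompact X) (hXc : IsClosed X) {f : E → ℝ} {K : ℝ}
    (hf : ∀ x ∈ X, ∀ y ∈ X, f x - f y ≤ K * dist x y) {v : ℕ → E} (hv : ∀ k, v k ∈ X)
    (hfreq : ∀ z ∈ X, ∀ ε > 0, ∃ᶠ k in atTop, f (v k) ≤ f z + ε) :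
    ∃ φ : ℕ → ℕ, StrictMono φ ∧
      ∀ x, MapClusterPt x atTop (fun n => v (φ n)) → x ∈ X ∧ IsMinOn f X x := by
  have hcont : ContinuousOn f X := by
    refine (LipschitzOnWith.of_le_add_mul' K fun x hx y hy => ?_).continuousOn
    linarith [hf x hx y hy]
  obtain ⟨z, hz, hzmin⟩ := hX.exists_isMinOn ⟨v 0, hv 0⟩ hcont
  obtain ⟨φ, hφ, hle⟩ := extraction_forall_of_frequently
    fun n : ℕ => hfreq z hz (1 / ((n : ℝ) + 1)) Nat.one_div_pos_of_nat
  refine ⟨φ, hφ, fun x hx => ?_⟩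
  have hxX : x ∈ X := by
    rw [← hXc.closure_eq]
    exact mem_closure_iff_clusterPt.2 (hx.clusterPt.mono (by
      rw [le_principal_iff, mem_map]
      exact Eventually.of_forall fun n => hv _))
  refine ⟨hxX, fun y hy => ?_⟩
  have hzy : f z ≤ f y := hzmin hy
  refine le_trans (b := f z) ?_ hzy
  refine le_of_forall_pos_le_add fun ε hε => ?_
  have hnear : ∀ᶠ w in 𝓝 x, K * dist x w < ε / 2 := by
    have hc : Continuous fun w => K * dist x w := by fun_prop
    refine hc.tendsto x (Iio_mem_nhds ?_)
    simpa using half_pos hε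
  obtain ⟨n, hn, hn'⟩ := ((mapClusterPt_iff_frequently.1 hx _ hnear).and_eventually
    (tendsto_one_div_add_atTop_nhds_zero_nat.eventually (gt_mem_nhds (half_pos hε)))).exists
  have h1 : K * dist x (v (φ n)) < ε / 2 := hn
  have h2 := hf x hxX _ (hv (φ n))
  have h3 := hle n
  linarith

end Descent

/-! ### Convergence of a run -/

section Convergence

variable {Ω : Type*} [MetricSpace Ω] [CompactSpace Ω] [MeasurableSpace Ω] [BorelSpace Ω]
  {dx m₁ dy m : ℕ} {D : Problem Ω dx m₁ dy m} {R : Trace Ω dx m} {γ : ℝ}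

/-- Convergence along a single run whose outcomes recur, jointly with the candidates and with the
incumbents, near every point of a closed set `K` containing the sample. -/
theorem Trace.IsRun.exists_subseq_isOptimal (hR : R.IsRun D γ) (hD : D.StandingAssumptions)
    {𝓕 : Set (Ω → ℝ)} (h𝓕 : D.AdmissibleClass 𝓕) (hγ₀ : 0 < γ) (hγ₁ : γ < 1)
    (hΘ : R.ThetaInvariant) (hθ : Tendsto R.θ atTop (𝓝 1))
    (hH : Tendsto (fun k => hausdorffDist 𝓕 D.ambiguity (R.approxSet k)) atTop (𝓝 0))
    {K : Set Ω} (hK : IsClosed K) (hsample : ∀ k, ∀ ω ∈ R.sample k, ω ∈ K)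
    (hcand : ∀ x, ∀ ω ∈ K, MapClusterPt x atTop (fun k => R.candidate (k + 1)) →
      MapClusterPt (x, ω) atTop fun k => (R.candidate (k + 1), R.obs (k + 1)))
    (hinc : ∀ x, ∀ ω ∈ K, MapClusterPt x atTop R.incumbent →
      MapClusterPt (x, ω) atTop fun k => (R.incumbent k, R.obs (k + 1))) :
    ∃ φ : ℕ → ℕ, StrictMono φ ∧ ∀ x : Fin dx → ℝ,
      MapClusterPt x atTop (fun n => R.incumbent (φ n)) → D.IsOptimal x := by
  obtain ⟨M, L, B, hb⟩ := hD.exists_hasBounds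
  set c₁ := ∑ i, |D.c i| with hc₁
  have hc₁0 : 0 ≤ c₁ := Finset.sum_nonneg fun i _ => abs_nonneg _
  have hc : ∀ x y : Fin dx → ℝ, D.c ⬝ᵥ x - D.c ⬝ᵥ y ≤ c₁ * ‖x - y‖ := fun x y => by
    rw [← dotProduct_sub]
    exact (le_abs_self _).trans (abs_dotProduct_le _ _)
  have hLip : ∀ x ∈ D.feasible, ∀ y ∈ D.feasible,
      D.objective x - D.objective y ≤ (c₁ + L) * dist x y := by
    intro x hx y hy
    have h1 := hD.worstCase_sub_le hb hx hy
    have h2 := hc x y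
    rw [dist_eq_norm, add_mul, Problem.objective, Problem.objective]
    linarith
  -- a cut generated at `y k` in iteration `k + 1` keeps the later models accurate near `y k`
  have hpersist : ∀ (y : ℕ → Fin dx → ℝ) (P : ℕ → Measure Ω) (π : ℕ → Ω → Fin m → ℝ),
      (∀ k, y k ∈ D.feasible) → (∀ k, R.IsExtremal D (k + 1) (y k) (P k)) →
      (∀ k, R.IsDualChoice D (k + 1) (y k) (π k)) →
      (∀ k, R.cut D (k + 1) (P k) (π k) ∈ R.cuts D (k + 1)) →
      (∀ k, D.recourse (y k) (R.obs (k + 1)) ≤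
        R.approxRecourse D (k + 1) (y k) (R.obs (k + 1))) →
      (∀ x, ∀ ω ∈ K, MapClusterPt x atTop y →
        MapClusterPt (x, ω) atTop fun k => (y k, R.obs (k + 1))) →
      ∀ ε > 0, ∀ n : ℕ, ∀ᶠ k in atTop, ∀ i ≤ n, ∀ z ∈ D.feasible,
        D.objective (y k) - (c₁ + L) * dist (y k) z - ε ≤ R.model D (k + 1 + i) z := by
    intro y P π hy hP hπ hmem hexact hrec ε hε n
    set η : ℝ := ε / (3 * (n + 1) * (B + 1)) with hη
    have hB := hb.B_nonneg
    have hη0 : 0 < η := by positivity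
    have hθη : ∀ᶠ k in atTop, ∀ i, k + 1 < i → 1 - η ≤ R.θ i := by
      obtain ⟨i₀, hi₀⟩ := eventually_atTop.1
        (hθ.eventually (lt_mem_nhds (show 1 - η < 1 by linarith)))
      exact eventually_atTop.2 ⟨i₀, fun k hk i hi => (hi₀ i (by omega)).le⟩
    filter_upwards [hθη, hR.eventually_abs_approxWorstCase_sub_le hD hb h𝓕 hH
      (show 0 < ε / 3 by positivity),
      hR.eventually_recourse_le_approxRecourse_add hD hb hy hexact hK hrec
      (show 0 < ε / 3 by positivity)] with k h1 h2 h3 i hi z hz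
    have h4 := hR.le_model_add hD hb (hP k) (hπ k) (hy k) (hmem k)
      (fun ω hω => h3 ω (hsample _ ω hω)) (η := η) (fun j hj => by
        obtain ⟨l, rfl⟩ : ∃ l, j = l + 1 := ⟨j - 1, by omega⟩
        exact ⟨(hΘ l (by omega)).1, h1 _ hj⟩) i hz
    have h5 := (abs_le.1 (h2 (y k) (hy k))).1
    have h6 := hc (y k) z
    have h7 : (i : ℝ) * η * B ≤ ε / 3 := by
      have hin : (i : ℝ) ≤ n := by exact_mod_cast hi
      calc (i : ℝ) * η * B ≤ (n + 1) * η * (B + 1) := by gcongr <;> linarith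
        _ = ε / 3 := by rw [hη]; field_simp
    rw [Problem.objective, dist_eq_norm, add_mul]
    linarith
  refine exists_subseq_mapClusterPt_isMinOn hD.feasible_compact hD.feasible_compact.isClosed hLip
    hR.incumbent_mem fun z hz ε hε => ?_
  refine frequently_incumbent_le hD.feasible_compact (add_nonneg hc₁0 hb.L_nonneg) hLip
    (F := R.model D) (x := fun k => R.candidate (k + 1)) hγ₀ hγ₁ hR.master_feasible
    hR.incumbent_mem hR.master_optimal ?_ ?_ ?_ ?_ hz hε
  · intro k
    have h := hR.incumbent_update k
    split_ifs at h with hif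
    · exact Or.inl ⟨hif, h⟩
    · exact Or.inr ⟨not_lt.1 hif, h⟩
  · intro ε hε
    obtain ⟨k₀, hk₀⟩ := eventually_atTop.1
      (hR.eventually_abs_approxWorstCase_sub_le hD hb h𝓕 hH hε)
    refine eventually_atTop.2 ⟨k₀ + 1, fun k hk z hz => ?_⟩
    obtain ⟨l, rfl⟩ : ∃ l, k = l + 1 := ⟨k - 1, by omega⟩
    have h1 := hR.model_le hD hb hΘ l hz
    have h2 := (abs_le.1 (hk₀ l (by omega) z hz)).2
    rw [Problem.objective]
    linarith
  · exact hpersist _ _ _ hR.master_feasible hR.candDist_extremal hR.candDual_choice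
      (fun k => Or.inr (Or.inl rfl)) (hR.recourse_le_approxRecourse_candidate hD) hcand
  · intro ε hε
    filter_upwards [hpersist _ _ _ hR.incumbent_mem hR.incDist_extremal hR.incDual_choice
      (fun k => Or.inr (Or.inr rfl)) (hR.recourse_le_approxRecourse_incumbent hD) hinc ε hε 0]
      with k hk
    simpa using hk 0 le_rfl _ (hR.incumbent_mem k)

end Convergence

end DRSD

theorem mainTheorem1 {Ω : Type*} [MetricSpace Ω] [CompactSpace Ω] [MeasurableSpace Ω]
    [BorelSpace Ω] {dx m₁ dy m : ℕ}
    (D : DRSD.Problem Ω dx m₁ dy m) (hD : D.StandingAssumptions)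
    (𝓕 : Set (Ω → ℝ)) (h𝓕 : D.AdmissibleClass 𝓕)
    (γ : ℝ) (hγ₀ : 0 < γ) (hγ₁ : γ < 1)
    {S : Type*} {mS : MeasurableSpace S} (ν : Measure S) [IsProbabilityMeasure ν]
    (𝒢 : Filtration ℕ mS) (μ : Measure Ω)
    (R : S → DRSD.Trace Ω dx m)
    (hsampling : DRSD.IsSequentialSampling ν 𝒢 μ R)
    (hrun : ∀ᵐ s ∂ν, (R s).IsRun D γ)
    (hmap : ∀ᵐ s ∂ν, (R s).ThetaInvariant)
    (hθ : ∀ᵐ s ∂ν, Tendsto (R s).θ atTop (𝓝 1))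
    (hhausdorff : ∀ᵐ s ∂ν,
      Tendsto (fun k => DRSD.hausdorffDist 𝓕 D.ambiguity ((R s).approxSet k)) atTop (𝓝 0)) :
    ∀ᵐ s ∂ν, ∃ φ : ℕ → ℕ, StrictMono φ ∧
      ∀ x : Fin dx → ℝ,
        MapClusterPt x atTop (fun n => (R s).incumbent (φ n)) → D.IsOptimal x := by
  have hsupp : ∀ᵐ s ∂ν, ∀ k, (R s).obs (k + 1) ∈ μ.support := by
    refine ae_all_iff.2 fun k => ?_
    have hm : Measurable fun s => (R s).obs (k + 1) :=
      (hsampling.obs_measurable k).mono (𝒢.le _) le_rfl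
    refine ae_of_ae_map hm.aemeasurable ?_
    rw [hsampling.obs_law k]
    exact Measure.support_mem_ae
  filter_upwards [hrun, hmap, hθ, hhausdorff, hsupp,
    DRSD.ae_mapClusterPt_prodMk hsampling.candidate_measurable hsampling.obs_measurable
      hsampling.obs_law hsampling.obs_indep,
    DRSD.ae_mapClusterPt_prodMk hsampling.incumbent_measurable hsampling.obs_measurable
      hsampling.obs_law hsampling.obs_indep] with s hR hΘ hθs hH hobs hcand hinc
  exact hR.exists_subseq_isOptimal hD h𝓕 hγ₀ hγ₁ hΘ hθs hH Measure.isClosed_support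
    (DRSD.Trace.sample_subset (hsampling.init_support s) hobs) hcand hinc
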